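/- Let $G$ be a second countable étale groupoid, that is, a topological groupoid, not assumed to be Hausdorff, whose unit space $G^{(0)}$ is locally compact Hausdorff in the relative topology and whose source map $s\colon G\to G^{(0)}$ is a local homeomorphism. Let $r$ be the range map, $G_x=s^{-1}(x)$ for $x\in G^{(0)}$, and $\mathrm{Iso}(G)=\{\gamma\in G: s(\gamma)=r(\gamma)\}$. Let $\mathcal C(G)$ be the linear span, in the space of all functions $G\to\mathbb C$, of the spaces $C_c(U)$ with $U\subseteq G$ open and Hausdorff (functions in $C_c(U)$ being extended by $0$), a $*$-algebra under $f*g(\gamma)=\sum_{\beta\in G_{s(\gamma)}}f(\gamma\beta^{-1})g(\beta)$ and $f^*(\gamma)=\overline{f(\gamma^{-1})}$. Let $C^*(G)$ be its completion in the universal norm $\|f\|=\sup\{\|\rho(f)\| : \rho \text{ a } *\text{-representation of } \mathcal C(G) \text{ on a Hilbert space}\}$, and let $C_0(G^{(0)})\subseteq C^*(G)$ be the closure of $C_c(G^{(0)})\subseteq\mathcal C(G)$. For $x\in G^{(0)}$ let $\lambda_x\colon C^*(G)\to B(\ell^2(G_x))$ be the $*$-representation that extends $(\lambda_x(f)\xi)(\gamma)=\sum_{\beta\in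 G_x}f(\gamma\beta^{-1})\xi(\beta)$, $f\in\mathcal C(G)$, and let $\delta_\gamma\in\ell^2(G_{s(\gamma)})$ be the delta function at $\gamma$. Say that $G$ has the full uniqueness property if every nonzero closed two-sided ideal $I$ of $C^*(G)$ satisfies $I\cap C_0(G^{(0)})\neq\{0\}$; that $G$ is effective if the interior of $\mathrm{Iso}(G)$ in $G$ equals $G^{(0)}$; and that $a\in C^*(G)$ is singular if the set $\{\gamma\in G : \langle\delta_\gamma\mid\lambda_{s(\gamma)}(a)\delta_{s(\gamma)}\rangle\neq0\}$ has empty interior in $G$. Then $G$ has the full uniqueness property if and only if $G$ is effective and $C^*(G)$ has no nonzero singular elements. -/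

import Mathlib

open Set Topology
open scoped ComplexConjugate ENNReal

universe u

/-- A groupoid in the set-theoretic sense: a set `G` of arrows with a distinguished subset of units,
source and range maps into the units, and a multiplication. The product `α * β` has a meaning only
when `src α = rng β`; no axiom constrains it for other pairs. -/
class SetGroupoid (G : Type u) extends Mul G, Inv G where
  units : Set G
  src : G → G
  rng : G → G
  src_mem : ∀ γ, src γ ∈ units
  rng_mem : ∀ γ, rng γ ∈ units
  src_unit : ∀ x ∈ units, src x = x
  rng_unit : ∀ x ∈ units, rng x = x
  mul_src_self : ∀ α : G, α * src α = α
  rng_mul_self : ∀ α : G, rng α * α = α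
  src_mul : ∀ α β : G, src α = rng β → src (α * β) = src β
  rng_mul : ∀ α β : G, src α = rng β → rng (α * β) = rng α
  mul_assoc' : ∀ α β γ : G, src α = rng β → src β = rng γ → (α * β) * γ = α * (β * γ)
  src_inv : ∀ γ : G, src γ⁻¹ = rng γ
  rng_inv : ∀ γ : G, rng γ⁻¹ = src γ
  inv_mul_self : ∀ γ : G, γ⁻¹ * γ = src γ
  mul_inv_self : ∀ γ : G, γ * γ⁻¹ = rng γ

namespace SetGroupoid

/-- The isotropy bundle `Iso(G)`. -/
def iso (G : Type u) [SetGroupoid G] : Set G := {γ | src γ = rng γ}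

/-- The fibre `G_x = s⁻¹(x)`. -/
abbrev Fiber {G : Type u} [SetGroupoid G] (x : G) : Type u := {γ : G // src γ = x}

end SetGroupoid

open SetGroupoid

/-- Multiplication is continuous on the set of composable pairs, and so is the inversion. -/
class IsTopologicalGroupoid (G : Type u) [TopologicalSpace G] [SetGroupoid G] : Prop where
  continuousOn_mul : ContinuousOn (fun p : G × G => p.1 * p.2) {p | src p.1 = rng p.2}
  continuous_inv : Continuous (fun γ : G => γ⁻¹)

/-- An étale groupoid, not assumed to be Hausdorff: the unit space is locally compact and Hausdorff
and the source map `G → G⁽⁰⁾` is a local homeomorphism. -/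
class IsEtaleGroupoid (G : Type u) [TopologicalSpace G] [SetGroupoid G] : Prop
    extends IsTopologicalGroupoid G where
  locallyCompact_units : LocallyCompactSpace (units : Set G)
  t2_units : T2Space (units : Set G)
  isLocalHomeomorph_src :
    IsLocalHomeomorph (fun γ : G => (⟨src γ, src_mem γ⟩ : (units : Set G)))

/-- `G` is effective if the interior of the isotropy bundle is the unit space. -/
def IsEffectiveGroupoid (G : Type u) [TopologicalSpace G] [SetGroupoid G] : Prop :=
  (units : Set G) = interior (iso G)

namespace SetGroupoid

section Algebra

variable {G : Type u} [SetGroupoid G]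

theorem src_src (γ : G) : src (src γ) = src γ := src_unit _ (src_mem γ)
theorem rng_src (γ : G) : rng (src γ) = src γ := rng_unit _ (src_mem γ)
theorem src_rng (γ : G) : src (rng γ) = rng γ := src_unit _ (rng_mem γ)
theorem rng_rng (γ : G) : rng (rng γ) = rng γ := rng_unit _ (rng_mem γ)

theorem mul_inv_mul {α β : G} (h : src α = src β) : (α * β⁻¹) * β = α := by
  rw [mul_assoc' _ _ _ (by rw [rng_inv, h]) (src_inv β), inv_mul_self, ← h, mul_src_self]

theorem mul_mul_inv {α β : G} (h : src α = rng β) : (α * β) * β⁻¹ = α := by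
  rw [mul_assoc' _ _ _ h (rng_inv β).symm, mul_inv_self, ← h, mul_src_self]

theorem inv_mul_mul {α β : G} (h : src α = rng β) : α⁻¹ * (α * β) = β := by
  rw [← mul_assoc' _ _ _ (src_inv α) h, inv_mul_self, h, rng_mul_self]

theorem inv_unique {α β : G} (h : src α = rng β) (h2 : α * β = src β) : α = β⁻¹ := by
  have := mul_mul_inv h
  rw [h2, ← rng_inv, rng_mul_self] at this
  exact this.symm

theorem inv_inv' (γ : G) : (γ⁻¹)⁻¹ = γ :=
  (inv_unique (rng_inv γ).symm (by rw [mul_inv_self, src_inv])).symm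

theorem mul_inv_rev' {α β : G} (h : src α = rng β) : (α * β)⁻¹ = β⁻¹ * α⁻¹ := by
  have h1 : src β⁻¹ = rng α⁻¹ := by rw [src_inv, rng_inv, h]
  refine (inv_unique ?_ ?_).symm
  · rw [src_mul _ _ h1, src_inv, rng_mul _ _ h]
  · rw [mul_assoc' _ _ _ h1 (by rw [src_inv, rng_mul _ _ h]), inv_mul_mul h, inv_mul_self,
      src_mul _ _ h]

theorem src_mul_inv {α β : G} (h : src α = src β) : src (α * β⁻¹) = rng β := by
  rw [src_mul _ _ (by rw [rng_inv, h]), src_inv]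

theorem rng_mul_inv {α β : G} (h : src α = src β) : rng (α * β⁻¹) = rng α :=
  rng_mul _ _ (by rw [rng_inv, h])

theorem mul_inv_inv {α β : G} (h : src α = src β) : (α * β⁻¹)⁻¹ = β * α⁻¹ := by
  rw [mul_inv_rev' (by rw [rng_inv, h]), inv_inv']

/-- `(α β⁻¹) (δ β⁻¹)⁻¹ = α δ⁻¹`. -/
theorem mul_inv_mul_inv {α β δ : G} (h : src α = src β) (h2 : src δ = src β) :
    (α * β⁻¹) * (δ * β⁻¹)⁻¹ = α * δ⁻¹ := by
  rw [mul_inv_inv h2, ← mul_assoc' _ _ _ (src_mul_inv h) (by rw [rng_inv, h2]), mul_inv_mul h]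

theorem mul_inv_right_cancel {α β δ : G} (h : src α = src δ) (h2 : src β = src δ)
    (h3 : α * δ⁻¹ = β * δ⁻¹) : α = β := by
  rw [← mul_inv_mul h, h3, mul_inv_mul h2]

theorem mul_inv_left_cancel {α β γ : G} (h : src γ = src α) (h2 : src γ = src β)
    (h3 : γ * α⁻¹ = γ * β⁻¹) : α = β := by
  have e1 := inv_mul_mul (α := γ) (β := α⁻¹) (by rw [rng_inv, h])
  have e2 := inv_mul_mul (α := γ) (β := β⁻¹) (by rw [rng_inv, h2])
  rw [h3, e2] at e1
  rw [← inv_inv' α, ← e1, inv_inv']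

theorem inv_of_unit {x : G} (hx : x ∈ (units : Set G)) : x⁻¹ = x := by
  refine (inv_unique (by rw [src_unit x hx, rng_unit x hx]) ?_).symm
  have := mul_src_self x
  rw [src_unit x hx] at this ⊢
  exact this

/-- Right translation by `β⁻¹` is a bijection from `G_{s(β)}` to `G_{r(β)}`. -/
def fiberEquiv (β : G) : Fiber (src β) ≃ Fiber (rng β) where
  toFun δ := ⟨δ.1 * β⁻¹, src_mul_inv δ.2⟩
  invFun α := ⟨α.1 * β, src_mul _ _ α.2⟩
  left_inv δ := Subtype.ext (mul_inv_mul δ.2)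
  right_inv α := Subtype.ext (mul_mul_inv α.2)

theorem finsum_fiber (β : G) {x y : G} (hx : src β = x) (hy : rng β = y) (F : G → ℂ) :
    ∑ᶠ α : Fiber y, F α.1 = ∑ᶠ δ : Fiber x, F (δ.1 * β⁻¹) := by
  subst hx hy
  exact (finsum_comp_equiv (fiberEquiv β)).symm

end Algebra

end SetGroupoid

namespace GroupoidCStar

section Convolution

variable {G : Type u} [SetGroupoid G]

/-- The action of a function `f` on a function `ξ` on `G_x`:
`(f ξ)(γ) = ∑_{β ∈ G_x} f(γβ⁻¹) ξ(β)`. -/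
noncomputable def leftAct (x : G) (f : G → ℂ) (ξ : Fiber x → ℂ) (γ : Fiber x) : ℂ :=
  ∑ᶠ β : Fiber x, f (γ.1 * β.1⁻¹) * ξ β

/-- Convolution: `(f * g)(γ) = ∑_{β ∈ G_{s(γ)}} f(γβ⁻¹) g(β)`. -/
noncomputable def conv (f g : G → ℂ) (γ : G) : ℂ :=
  ∑ᶠ β : Fiber (src γ), f (γ * β.1⁻¹) * g β.1

/-- Involution: `f^*(γ) = conj f(γ⁻¹)`. -/
noncomputable def invol (f : G → ℂ) (γ : G) : ℂ := conj (f γ⁻¹)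

/-- The support of `f` meets every range fibre and every source fibre in a finite set. -/
def FiniteOnFibers (f : G → ℂ) : Prop :=
  (∀ x, {γ | rng γ = x ∧ f γ ≠ 0}.Finite) ∧ (∀ x, {γ | src γ = x ∧ f γ ≠ 0}.Finite)

theorem conv_eq_leftAct (x : G) (f g : G → ℂ) (γ : Fiber x) :
    conv f g γ.1 = leftAct x f (fun β => g β.1) γ := by
  obtain ⟨γ, rfl⟩ := γ
  rfl

theorem FiniteOnFibers.left {f : G → ℂ} (hf : FiniteOnFibers f) {x : G} (γ : Fiber x) :
    {β : Fiber x | f (γ.1 * β.1⁻¹) ≠ 0}.Finite := by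
  refine Set.Finite.of_finite_image (f := fun β : Fiber x => γ.1 * β.1⁻¹)
    ((hf.1 (rng γ.1)).subset ?_) ?_
  · rintro _ ⟨β, hβ, rfl⟩
    exact ⟨rng_mul_inv (γ.2.trans β.2.symm), hβ⟩
  · intro α _ β _ h
    exact Subtype.ext (mul_inv_left_cancel (γ.2.trans α.2.symm) (γ.2.trans β.2.symm) h)

theorem FiniteOnFibers.right {f : G → ℂ} (hf : FiniteOnFibers f) {x : G} (β : Fiber x) :
    {γ : Fiber x | f (γ.1 * β.1⁻¹) ≠ 0}.Finite := by
  refine Set.Finite.of_finite_image (f := fun γ : Fiber x => γ.1 * β.1⁻¹)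
    ((hf.2 (rng β.1)).subset ?_) ?_
  · rintro _ ⟨γ, hγ, rfl⟩
    exact ⟨src_mul_inv (γ.2.trans β.2.symm), hγ⟩
  · intro α _ γ _ h
    exact Subtype.ext (mul_inv_right_cancel (α.2.trans β.2.symm) (γ.2.trans β.2.symm) h)

theorem FiniteOnFibers.summand {f : G → ℂ} (hf : FiniteOnFibers f) {x : G} (γ : Fiber x)
    (ξ : Fiber x → ℂ) :
    Function.HasFiniteSupport (fun β : Fiber x => f (γ.1 * β.1⁻¹) * ξ β) :=
  (hf.left γ).subset fun _ hβ => left_ne_zero_of_mul hβ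

theorem FiniteOnFibers.add {f g : G → ℂ} (hf : FiniteOnFibers f) (hg : FiniteOnFibers g) :
    FiniteOnFibers (f + g) := by
  constructor
  · intro x
    refine ((hf.1 x).union (hg.1 x)).subset ?_
    rintro γ ⟨h, h2⟩
    by_cases h3 : f γ = 0
    · exact Or.inr ⟨h, fun h4 => h2 (by simp [h3, h4])⟩
    · exact Or.inl ⟨h, h3⟩
  · intro x
    refine ((hf.2 x).union (hg.2 x)).subset ?_
    rintro γ ⟨h, h2⟩
    by_cases h3 : f γ = 0
    · exact Or.inr ⟨h, fun h4 => h2 (by simp [h3, h4])⟩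
    · exact Or.inl ⟨h, h3⟩

theorem FiniteOnFibers.smul (c : ℂ) {f : G → ℂ} (hf : FiniteOnFibers f) :
    FiniteOnFibers (c • f) := by
  constructor
  · exact fun x => (hf.1 x).subset fun γ h => ⟨h.1, fun h4 => h.2 (by simp [h4])⟩
  · exact fun x => (hf.2 x).subset fun γ h => ⟨h.1, fun h4 => h.2 (by simp [h4])⟩

theorem FiniteOnFibers.zero : FiniteOnFibers (0 : G → ℂ) := by
  constructor <;> simp

theorem leftAct_add_left {f g : G → ℂ} (hf : FiniteOnFibers f) (hg : FiniteOnFibers g) (x : G)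
    (ξ : Fiber x → ℂ) : leftAct x (f + g) ξ = leftAct x f ξ + leftAct x g ξ := by
  funext γ
  simp only [leftAct, Pi.add_apply, add_mul]
  exact finsum_add_distrib (hf.summand γ ξ) (hg.summand γ ξ)

theorem leftAct_add_right {f : G → ℂ} (hf : FiniteOnFibers f) (x : G)
    (ξ η : Fiber x → ℂ) : leftAct x f (ξ + η) = leftAct x f ξ + leftAct x f η := by
  funext γ
  simp only [leftAct, Pi.add_apply, mul_add]
  exact finsum_add_distrib (hf.summand γ ξ) (hf.summand γ η)

theorem leftAct_smul_left (c : ℂ) (f : G → ℂ) (x : G)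
    (ξ : Fiber x → ℂ) : leftAct x (c • f) ξ = c • leftAct x f ξ := by
  funext γ
  simp only [leftAct, Pi.smul_apply, smul_finsum, smul_mul_assoc]

theorem leftAct_smul_right (c : ℂ) (f : G → ℂ) (x : G)
    (ξ : Fiber x → ℂ) : leftAct x f (c • ξ) = c • leftAct x f ξ := by
  funext γ
  simp only [leftAct, Pi.smul_apply, smul_finsum, mul_smul_comm]

theorem conv_eq_fiber {x : G} (f g : G → ℂ) (γ β : Fiber x) :
    conv f g (γ.1 * β.1⁻¹) = ∑ᶠ δ : Fiber x, f (γ.1 * δ.1⁻¹) * g (δ.1 * β.1⁻¹) := by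
  have h := γ.2.trans β.2.symm
  rw [conv, finsum_fiber β.1 β.2 (src_mul_inv h).symm
    (fun α => f ((γ.1 * β.1⁻¹) * α⁻¹) * g α)]
  exact finsum_congr fun δ => by rw [mul_inv_mul_inv h (δ.2.trans β.2.symm)]

theorem leftAct_conv {f g : G → ℂ} (hf : FiniteOnFibers f) (hg : FiniteOnFibers g) (x : G)
    (ξ : Fiber x → ℂ) : leftAct x (conv f g) ξ = leftAct x f (leftAct x g ξ) := by
  funext γ
  have hfin : Function.HasFiniteSupport
      (fun p : Fiber x × Fiber x => f (γ.1 * p.1.1⁻¹) * (g (p.1.1 * p.2.1⁻¹) * ξ p.2)) := by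
    refine ((hf.left γ).biUnion fun δ _ => (hg.left δ).image (fun β => (δ, β))).subset ?_
    rintro ⟨δ, β⟩ h
    simp only [Function.mem_support] at h
    refine Set.mem_biUnion (left_ne_zero_of_mul h) ⟨β, ?_, rfl⟩
    exact left_ne_zero_of_mul (right_ne_zero_of_mul h)
  have hfin' : Function.HasFiniteSupport
      (fun p : Fiber x × Fiber x => f (γ.1 * p.2.1⁻¹) * (g (p.2.1 * p.1.1⁻¹) * ξ p.1)) := by
    refine (Set.Finite.image Prod.swap hfin).subset ?_
    rintro ⟨δ, β⟩ h
    exact ⟨(β, δ), h, rfl⟩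
  have e1 : leftAct x (conv f g) ξ γ = ∑ᶠ (β : Fiber x) (δ : Fiber x),
      f (γ.1 * δ.1⁻¹) * (g (δ.1 * β.1⁻¹) * ξ β) := by
    refine finsum_congr fun β => ?_
    rw [conv_eq_fiber, mul_comm, ← smul_eq_mul, smul_finsum]
    exact finsum_congr fun δ => by simp only [smul_eq_mul]; ring
  have e2 : leftAct x f (leftAct x g ξ) γ = ∑ᶠ (δ : Fiber x) (β : Fiber x),
      f (γ.1 * δ.1⁻¹) * (g (δ.1 * β.1⁻¹) * ξ β) := by
    refine finsum_congr fun δ => ?_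
    rw [leftAct, ← smul_eq_mul, smul_finsum]
    rfl
  rw [e1, e2, ← finsum_curry _ hfin, ← finsum_curry _ hfin']
  exact finsum_comp_equiv (Equiv.prodComm (Fiber x) (Fiber x))
    (f := fun p => f (γ.1 * p.1.1⁻¹) * (g (p.1.1 * p.2.1⁻¹) * ξ p.2))

theorem conv_assoc {f g : G → ℂ} (hf : FiniteOnFibers f) (hg : FiniteOnFibers g) (h : G → ℂ) :
    conv (conv f g) h = conv f (conv g h) := by
  funext γ
  have e : (fun β : Fiber (src γ) => conv g h β.1) = leftAct (src γ) g (fun β => h β.1) :=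
    funext fun β => conv_eq_leftAct _ g h β
  rw [conv_eq_leftAct (src γ) _ _ ⟨γ, rfl⟩, conv_eq_leftAct (src γ) _ _ ⟨γ, rfl⟩,
    leftAct_conv hf hg, e]

theorem conv_add_left {f g : G → ℂ} (hf : FiniteOnFibers f) (hg : FiniteOnFibers g) (h : G → ℂ) :
    conv (f + g) h = conv f h + conv g h := by
  funext γ
  exact congrFun (leftAct_add_left hf hg (src γ) (fun β => h β.1)) ⟨γ, rfl⟩

theorem conv_add_right {f : G → ℂ} (hf : FiniteOnFibers f) (g h : G → ℂ) :
    conv f (g + h) = conv f g + conv f h := by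
  funext γ
  exact congrFun (leftAct_add_right hf (src γ) (fun β => g β.1) (fun β => h β.1)) ⟨γ, rfl⟩

theorem conv_smul_left (c : ℂ) (f g : G → ℂ) : conv (c • f) g = c • conv f g := by
  funext γ
  exact congrFun (leftAct_smul_left c f (src γ) (fun β => g β.1)) ⟨γ, rfl⟩

theorem conv_smul_right (c : ℂ) (f g : G → ℂ) : conv f (c • g) = c • conv f g := by
  funext γ
  exact congrFun (leftAct_smul_right c f (src γ) (fun β => g β.1)) ⟨γ, rfl⟩

theorem conv_zero_left (g : G → ℂ) : conv 0 g = 0 := by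
  simpa using conv_smul_left 0 0 g

theorem conv_zero_right (f : G → ℂ) : conv f 0 = 0 := by
  simpa using conv_smul_right 0 f 0

theorem invol_invol (f : G → ℂ) : invol (invol f) = f := by
  funext γ; simp [invol, inv_inv']

theorem invol_add (f g : G → ℂ) : invol (f + g) = invol f + invol g := by
  funext γ; simp [invol]

theorem invol_smul (c : ℂ) (f : G → ℂ) : invol (c • f) = conj c • invol f := by
  funext γ; simp [invol]

theorem invol_conv (f g : G → ℂ) : invol (conv f g) = conv (invol g) (invol f) := by
  funext γ
  have hs : src γ⁻¹ = rng γ := src_inv γ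
  have e : invol (conv f g) γ = ∑ᶠ β : Fiber (src γ⁻¹), conj (f (γ⁻¹ * β.1⁻¹) * g β.1) :=
    (starRingAut (R := ℂ)).toAddEquiv.map_finsum _
  rw [e, finsum_fiber γ rfl hs.symm (fun β => conj (f (γ⁻¹ * β⁻¹) * g β))]
  refine finsum_congr fun δ => ?_
  have h : (γ⁻¹ : G) * (δ.1 * γ⁻¹)⁻¹ = δ.1⁻¹ := by
    rw [mul_inv_inv δ.2, inv_mul_mul (by rw [rng_inv, δ.2])]
  simp only [invol, h, mul_inv_inv δ.2.symm, map_mul]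
  ring

/-- Functions supported on the units multiply pointwise. -/
theorem conv_of_units {h k : G → ℂ} (hh : ∀ γ, γ ∉ (units : Set G) → h γ = 0)
    (hk : ∀ γ, γ ∉ (units : Set G) → k γ = 0) : conv h k = fun γ => h γ * k γ := by
  funext γ
  rw [conv, finsum_eq_single _ (⟨src γ, src_src γ⟩ : Fiber (src γ))]
  · change h (γ * (src γ)⁻¹) * k (src γ) = h γ * k γ
    rw [inv_of_unit (src_mem γ), mul_src_self]
    by_cases hγ : γ ∈ (units : Set G)
    · rw [src_unit γ hγ]
    · rw [hh γ hγ, zero_mul, zero_mul]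
  · intro β hβ
    have : β.1 ∉ (units : Set G) := fun h2 =>
      hβ (Subtype.ext ((src_unit _ h2).symm.trans β.2))
    rw [hk _ this, mul_zero]

end Convolution

section Functions

variable {G : Type u} [TopologicalSpace G] [SetGroupoid G]

/-- `C_c(U)`, its elements being extended by `0` to functions on `G`. -/
def CcOn (U : Set G) : Set (G → ℂ) :=
  {f | ContinuousOn f U ∧ ∃ K ⊆ U, IsCompact K ∧ ∀ γ ∉ K, f γ = 0}

/-- The space `𝒞(G)`: the linear span of the `C_c(U)`, `U ⊆ G` open and Hausdorff. -/
def ccSpan (G : Type u) [TopologicalSpace G] [SetGroupoid G] : Submodule ℂ (G → ℂ) :=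
  Submodule.span ℂ {f | ∃ U : Set G, IsOpen U ∧ T2Space U ∧ f ∈ CcOn U}

/-- A bisection: the source and the range map are injective on `U`. -/
def IsBisection (U : Set G) : Prop := InjOn src U ∧ InjOn rng U

/-- The functions that belong to `C_c(U)` for an open bisection `U`. -/
def bisectionFns (G : Type u) [TopologicalSpace G] [SetGroupoid G] : Set (G → ℂ) := {f | ∃ U : Set G, IsOpen U ∧ IsBisection U ∧ f ∈ CcOn U}

theorem finiteOnFibers_bisection {f : G → ℂ} (hf : f ∈ bisectionFns G) : FiniteOnFibers f := by
  obtain ⟨U, -, hb, -, K, hKU, -, h0⟩ := hf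
  have hU : ∀ γ, f γ ≠ 0 → γ ∈ U := fun γ h => hKU (by_contra fun h2 => h (h0 γ h2))
  constructor
  · intro x
    refine Set.Subsingleton.finite fun α hα β hβ => ?_
    exact hb.2 (hU _ hα.2) (hU _ hβ.2) (hα.1.trans hβ.1.symm)
  · intro x
    refine Set.Subsingleton.finite fun α hα β hβ => ?_
    exact hb.1 (hU _ hα.2) (hU _ hβ.2) (hα.1.trans hβ.1.symm)

variable [IsEtaleGroupoid G]

theorem continuous_src : Continuous (src : G → G) :=
  continuous_subtype_val.comp (IsEtaleGroupoid.isLocalHomeomorph_src (G := G)).continuous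

theorem continuous_inv : Continuous (fun γ : G => γ⁻¹) :=
  IsTopologicalGroupoid.continuous_inv

theorem continuous_rng : Continuous (rng : G → G) := by
  have : (rng : G → G) = src ∘ (fun γ : G => γ⁻¹) := funext fun γ => (src_inv γ).symm
  rw [this]
  exact continuous_src.comp continuous_inv

theorem isOpen_src_saturation {V : Set G} (hV : IsOpen V) : IsOpen {γ : G | src γ ∈ src '' V} := by
  have h := (IsEtaleGroupoid.isLocalHomeomorph_src (G := G)).isOpenMap V hV
  convert! h.preimage (IsEtaleGroupoid.isLocalHomeomorph_src (G := G)).continuous using 1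
  ext γ
  simp [Subtype.ext_iff]

theorem isClosed_eq_units {X : Type*} [TopologicalSpace X] {a b : X → G} (ha : Continuous a)
    (hb : Continuous b) (ha' : ∀ x, a x ∈ (units : Set G)) (hb' : ∀ x, b x ∈ (units : Set G)) :
    IsClosed {x | a x = b x} := by
  have := IsEtaleGroupoid.t2_units (G := G)
  have := isClosed_eq (f := fun x => (⟨a x, ha' x⟩ : (units : Set G)))
    (g := fun x => (⟨b x, hb' x⟩ : (units : Set G))) (ha.subtype_mk _) (hb.subtype_mk _)
  simpa [Subtype.ext_iff] using this

theorem IsBisection.t2Space {U : Set G} (hU : IsBisection U) : T2Space U := by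
  have := IsEtaleGroupoid.t2_units (G := G)
  refine T2Space.of_injective_continuous
    (f := fun γ : U => (⟨src γ.1, src_mem γ.1⟩ : (units : Set G))) ?_
    ((continuous_src.comp continuous_subtype_val).subtype_mk _)
  intro α β h
  exact Subtype.ext (hU.1 α.2 β.2 (by simpa using h))

theorem exists_bisection (γ : G) {N : Set G} (hN : IsOpen N) (hγ : γ ∈ N) :
    ∃ U ⊆ N, IsOpen U ∧ γ ∈ U ∧ IsBisection U := by
  have key : ∀ γ : G, ∃ U : Set G, IsOpen U ∧ γ ∈ U ∧ InjOn src U := by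
    intro γ
    obtain ⟨e, he, h⟩ := IsEtaleGroupoid.isLocalHomeomorph_src (G := G) γ
    refine ⟨e.source, e.open_source, he, fun α hα β hβ hab => e.injOn hα hβ ?_⟩
    rw [← h]
    exact Subtype.ext hab
  obtain ⟨U, hU, hγU, hi⟩ := key γ
  obtain ⟨V, hV, hγV, hj⟩ := key γ⁻¹
  refine ⟨N ∩ (U ∩ (fun γ : G => γ⁻¹) ⁻¹' V), inter_subset_left,
    hN.inter (hU.inter (hV.preimage continuous_inv)), ⟨hγ, hγU, hγV⟩, ?_, ?_⟩
  · exact hi.mono fun x hx => hx.2.1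
  · intro α hα β hβ hab
    have : α⁻¹ = β⁻¹ := hj hα.2.2 hβ.2.2 (by rw [src_inv, src_inv, hab])
    rw [← inv_inv' α, this, inv_inv']

theorem isOpen_units : IsOpen (units : Set G) := by
  refine isOpen_iff_forall_mem_open.2 fun x hx => ?_
  obtain ⟨U, -, hU, hxU, hb⟩ := exists_bisection x isOpen_univ (mem_univ x)
  refine ⟨U ∩ src ⁻¹' U, ?_, hU.inter (hU.preimage continuous_src), hxU, ?_⟩
  · rintro γ ⟨hγ, hγ'⟩
    rw [hb.1 hγ hγ' (src_src γ).symm]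
    exact src_mem γ
  · rwa [mem_preimage, src_unit x hx]

/-- `C_c(G⁽⁰⁾) ⊆ 𝒞(G)`. -/
theorem ccOn_units_subset : CcOn (units : Set G) ⊆ ccSpan G := fun _ hf =>
  Submodule.subset_span ⟨units, isOpen_units, IsEtaleGroupoid.t2_units, hf⟩

theorem bisectionFns_subset : bisectionFns G ⊆ ccSpan G := by
  rintro f ⟨U, hU, hb, hf⟩
  exact Submodule.subset_span ⟨U, hU, hb.t2Space, hf⟩

theorem locallyCompact_open {U : Set G} (hU : IsOpen U) : LocallyCompactSpace U := by
  have := IsEtaleGroupoid.locallyCompact_units (G := G)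
  have h : LocallyCompactSpace G := by
    refine ⟨fun γ n hn => ?_⟩
    obtain ⟨e, he, -⟩ := IsEtaleGroupoid.isLocalHomeomorph_src (G := G) γ
    have h1 : e.symm ⁻¹' (n) ∩ e.target ∈ 𝓝 (e γ) := by
      refine Filter.inter_mem ?_ (e.open_target.mem_nhds (e.map_source he))
      exact (e.continuousAt_symm (e.map_source he)) (by rwa [e.left_inv he])
    obtain ⟨K, hK, hKn, hKc⟩ := local_compact_nhds h1
    refine ⟨e.symm '' K, ?_, ?_, ?_⟩
    · rw [← e.left_inv he]
      exact e.symm.image_mem_nhds (e.map_source he) hK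
    · rintro _ ⟨x, hx, rfl⟩
      exact (hKn hx).1
    · exact hKc.image_of_continuousOn (e.continuousOn_symm.mono fun x hx => (hKn hx).2)
  exact hU.isOpenEmbedding_subtypeVal.locallyCompactSpace

/-- By a partition of unity, open bisections suffice to span `𝒞(G)`. -/
theorem ccSpan_eq_span_bisection : ccSpan G = Submodule.span ℂ (bisectionFns G) := by
  refine le_antisymm (Submodule.span_le.2 ?_) (Submodule.span_le.2 bisectionFns_subset)
  rintro f ⟨U, hU, hT2, hf, K, hKU, hK, h0⟩
  have := locallyCompact_open hU
  choose V hVU hV hmem hbis using fun γ : U => exists_bisection γ.1 hU γ.2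
  have hK' : IsCompact ((↑) ⁻¹' K : Set U) :=
    Topology.IsInducing.subtypeVal.isCompact_preimage_iff (by
      rw [Subtype.range_coe]; exact hKU) |>.2 hK
  obtain ⟨t, ht⟩ := hK'.elim_finite_subcover (fun γ : U => ((↑) ⁻¹' V γ : Set U))
    (fun γ => (hV γ).preimage continuous_subtype_val)
    (by intro γ _; rw [mem_iUnion]; exact ⟨γ, hmem γ⟩)
  let s : Fin t.card → Set U := fun i => (↑) ⁻¹' V (t.equivFin.symm i).1
  have hcov : ((↑) ⁻¹' K : Set U) ⊆ ⋃ i, s i := by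
    intro γ hγ
    obtain ⟨δ, hδ, hγδ⟩ := mem_iUnion₂.1 (ht hγ)
    exact mem_iUnion.2 ⟨t.equivFin ⟨δ, hδ⟩, by simpa [s] using hγδ⟩
  obtain ⟨φ, hsup, hsum, -, hcs⟩ := exists_continuous_sum_one_of_isOpen_isCompact (s := s)
    (fun i => (hV _).preimage continuous_subtype_val) hK' hcov
  classical
  let g : Fin t.card → G → ℂ := fun i γ => if h : γ ∈ U then (φ i ⟨γ, h⟩ : ℂ) * f γ else 0
  have hfg : f = ∑ i, g i := by
    funext γ
    rw [Finset.sum_apply]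
    by_cases hγ : γ ∈ K
    · have hγU := hKU hγ
      have h1 : ∑ i, φ i ⟨γ, hγU⟩ = 1 := by
        simpa using hsum (show (⟨γ, hγU⟩ : U) ∈ ((↑) ⁻¹' K : Set U) from hγ)
      simp only [g, dif_pos hγU, ← Finset.sum_mul]
      rw [← Complex.ofReal_sum, h1]
      simp
    · rw [h0 γ hγ, Finset.sum_eq_zero]
      intro i _
      simp [g, h0 γ hγ]
  rw [hfg]
  refine Submodule.sum_mem _ fun i _ => Submodule.subset_span
    ⟨V (t.equivFin.symm i).1, hV _, hbis _, ?_, (↑) '' (tsupport (φ i)), ?_, ?_, ?_⟩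
  · refine ContinuousOn.mono ?_ (hVU _)
    rw [continuousOn_iff_continuous_domRestrict]
    have : U.domRestrict (g i) = fun γ : U => (φ i γ : ℂ) * U.domRestrict f γ := by
      funext γ
      simp [g]
    rw [this]
    exact (Complex.continuous_ofReal.comp (φ i).continuous).mul
      (continuousOn_iff_continuous_domRestrict.1 hf)
  · rintro _ ⟨γ, hγ, rfl⟩
    exact hsup i hγ
  · exact (hcs i).isCompact.image continuous_subtype_val
  · intro γ hγ
    by_cases h : γ ∈ U
    · have : φ i ⟨γ, h⟩ = 0 := by
        by_contra h2
        exact hγ ⟨⟨γ, h⟩, subset_tsupport _ h2, rfl⟩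
      simp [g, h, this]
    · simp [g, h]

theorem finiteOnFibers {f : G → ℂ} (hf : f ∈ ccSpan G) : FiniteOnFibers f := by
  rw [ccSpan_eq_span_bisection] at hf
  induction hf using Submodule.span_induction with
  | mem f h => exact finiteOnFibers_bisection h
  | zero => exact FiniteOnFibers.zero
  | add f g _ _ h1 h2 => exact h1.add h2
  | smul c f _ h => exact h.smul c

theorem invol_mem {f : G → ℂ} (hf : f ∈ ccSpan G) : invol f ∈ ccSpan G := by
  rw [ccSpan_eq_span_bisection] at hf
  induction hf using Submodule.span_induction with
  | mem f h =>
    obtain ⟨U, hU, hb, hc, K, hKU, hK, h0⟩ := h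
    refine bisectionFns_subset ⟨(fun γ => γ⁻¹) ⁻¹' U, hU.preimage continuous_inv, ?_, ?_,
      (fun γ => γ⁻¹) '' K, ?_, hK.image continuous_inv, ?_⟩
    · constructor
      · intro α hα β hβ h
        have : α⁻¹ = β⁻¹ := hb.2 hα hβ (by rw [rng_inv, rng_inv, h])
        rw [← inv_inv' α, this, inv_inv']
      · intro α hα β hβ h
        have : α⁻¹ = β⁻¹ := hb.1 hα hβ (by rw [src_inv, src_inv, h])
        rw [← inv_inv' α, this, inv_inv']
    · exact Complex.continuous_conj.comp_continuousOn
        (hc.comp continuous_inv.continuousOn fun γ h => h)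
    · rintro _ ⟨γ, hγ, rfl⟩
      simpa [inv_inv'] using hKU hγ
    · intro γ hγ
      have : f γ⁻¹ = 0 := h0 _ fun h => hγ ⟨_, h, inv_inv' γ⟩
      simp [invol, this]
  | zero => convert (ccSpan G).zero_mem using 1; funext γ; simp [invol]
  | add f g _ _ h1 h2 => rw [invol_add]; exact Submodule.add_mem _ h1 h2
  | smul c f _ h => rw [invol_smul]; exact Submodule.smul_mem _ _ h

/-- The product of two elements of `C_c(U)` and `C_c(V)` belongs to `C_c(UV)`. -/
theorem conv_bisection {U V : Set G} (hU : IsOpen U) (hUb : IsBisection U) (hV : IsOpen V)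
    (hVb : IsBisection V) {f g : G → ℂ} (hf : f ∈ CcOn U) (hg : g ∈ CcOn V) :
    ∃ W : Set G, IsOpen W ∧ IsBisection W ∧ conv f g ∈ CcOn W ∧
      (∀ γ ∈ W, ∃ α ∈ U, ∃ β ∈ V, src α = rng β ∧ γ = α * β ∧ conv f g γ = f α * g β) := by
  obtain ⟨hfc, K, hKU, hK, hf0⟩ := hf
  obtain ⟨hgc, L, hLV, hL, hg0⟩ := hg
  have hfU : ∀ γ, f γ ≠ 0 → γ ∈ U := fun γ h => hKU (by_contra fun h2 => h (hf0 γ h2))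
  have hgV : ∀ γ, g γ ≠ 0 → γ ∈ V := fun γ h => hLV (by_contra fun h2 => h (hg0 γ h2))
  let D : Set G := {γ | src γ ∈ src '' V}
  have hD : IsOpen D := isOpen_src_saturation hV
  have hex : ∀ γ : G, ∃ β, γ ∈ D → β ∈ V ∧ src β = src γ := by
    intro γ
    by_cases h : γ ∈ D
    · obtain ⟨β, hβ, hβγ⟩ := h
      exact ⟨β, fun _ => ⟨hβ, hβγ⟩⟩
    · exact ⟨γ, fun h2 => absurd h2 h⟩
  choose b hb using hex
  have hbc : ContinuousOn b D := by
    intro γ hγ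
    refine ContinuousAt.continuousWithinAt ?_
    intro N hN
    obtain ⟨N', hN'N, hN', hγN'⟩ := mem_nhds_iff.1 hN
    have h1 : IsOpen {δ : G | src δ ∈ src '' (N' ∩ V)} := isOpen_src_saturation (hN'.inter hV)
    have h2 : γ ∈ {δ : G | src δ ∈ src '' (N' ∩ V)} :=
      ⟨b γ, ⟨hγN', (hb γ hγ).1⟩, (hb γ hγ).2⟩
    rw [Filter.mem_map]
    filter_upwards [h1.mem_nhds h2] with δ hδ
    obtain ⟨β, ⟨hβN, hβV⟩, hβδ⟩ := hδ
    have hδD : δ ∈ D := ⟨β, hβV, hβδ⟩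
    have : b δ = β := hVb.1 (hb δ hδD).1 hβV ((hb δ hδD).2.trans hβδ.symm)
    exact hN'N (this ▸ hβN)
  have hac : ContinuousOn (fun γ => γ * (b γ)⁻¹) D := by
    refine (IsTopologicalGroupoid.continuousOn_mul (G := G)).comp
      (continuousOn_id.prodMk (continuous_inv.comp_continuousOn hbc)) ?_
    intro γ hγ
    change src γ = rng (b γ)⁻¹
    rw [rng_inv, (hb γ hγ).2]
  let W : Set G := D ∩ (fun γ => γ * (b γ)⁻¹) ⁻¹' U
  have hval : ∀ γ ∈ D, conv f g γ = f (γ * (b γ)⁻¹) * g (b γ) := by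
    intro γ hγ
    refine finsum_eq_single _ (⟨b γ, (hb γ hγ).2⟩ : Fiber (src γ)) ?_
    intro β hβ
    by_contra h
    have hβV := hgV _ (right_ne_zero_of_mul h)
    exact hβ (Subtype.ext (hVb.1 hβV (hb γ hγ).1 (β.2.trans (hb γ hγ).2.symm)))
  have hWeq : ∀ γ ∈ W, src (γ * (b γ)⁻¹) = rng (b γ) ∧ γ = γ * (b γ)⁻¹ * b γ := by
    intro γ hγ
    have h := (hb γ hγ.1).2.symm
    exact ⟨src_mul_inv h, (mul_inv_mul h).symm⟩
  refine ⟨W, hac.isOpen_inter_preimage hD hU, ⟨?_, ?_⟩, ⟨?_, ?_⟩, ?_⟩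
  · intro γ hγ δ hδ h
    have e1 : b γ = b δ :=
      hVb.1 (hb γ hγ.1).1 (hb δ hδ.1).1 (by rw [(hb γ hγ.1).2, (hb δ hδ.1).2, h])
    have e2 : γ * (b γ)⁻¹ = δ * (b δ)⁻¹ := by
      refine hUb.1 hγ.2 hδ.2 ?_
      rw [(hWeq γ hγ).1, (hWeq δ hδ).1, e1]
    rw [(hWeq γ hγ).2, (hWeq δ hδ).2, e2, e1]
  · intro γ hγ δ hδ h
    have e2 : γ * (b γ)⁻¹ = δ * (b δ)⁻¹ := by
      refine hUb.2 hγ.2 hδ.2 ?_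
      rw [rng_mul_inv (hb γ hγ.1).2.symm, rng_mul_inv (hb δ hδ.1).2.symm, h]
    have e1 : b γ = b δ :=
      hVb.2 (hb γ hγ.1).1 (hb δ hδ.1).1 (by rw [← (hWeq γ hγ).1, ← (hWeq δ hδ).1, e2])
    rw [(hWeq γ hγ).2, (hWeq δ hδ).2, e2, e1]
  · refine ContinuousOn.congr ?_ fun γ hγ => hval γ hγ.1
    exact (hfc.comp (hac.mono inter_subset_left) fun γ hγ => hγ.2).mul
      (hgc.comp (hbc.mono inter_subset_left) fun γ hγ => (hb γ hγ.1).1)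
  · have hcl : IsClosed {p : G × G | src p.1 = rng p.2} :=
      isClosed_eq_units (continuous_src.comp continuous_fst) (continuous_rng.comp continuous_snd)
        (fun _ => src_mem _) (fun _ => rng_mem _)
    refine ⟨(fun p : G × G => p.1 * p.2) '' ((K ×ˢ L) ∩ {p | src p.1 = rng p.2}), ?_, ?_, ?_⟩
    · rintro _ ⟨⟨α, β⟩, ⟨⟨hα, hβ⟩, h⟩, rfl⟩
      have h' : src α = rng β := h
      have hs : src (α * β) = src β := src_mul _ _ h'
      have hD' : α * β ∈ D := ⟨β, hLV hβ, hs.symm⟩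
      have hbe : b (α * β) = β := hVb.1 (hb _ hD').1 (hLV hβ) ((hb _ hD').2.trans hs)
      refine ⟨hD', ?_⟩
      change α * β * (b (α * β))⁻¹ ∈ U
      rw [hbe, mul_mul_inv h']
      exact hKU hα
    · exact ((hK.prod hL).inter_right hcl).image_of_continuousOn
        ((IsTopologicalGroupoid.continuousOn_mul (G := G)).mono inter_subset_right)
    · intro γ hγ
      refine finsum_eq_zero_of_forall_eq_zero fun β => ?_
      by_contra h
      have h1 : γ * β.1⁻¹ ∈ K := by_contra fun h2 => left_ne_zero_of_mul h (hf0 _ h2)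
      have h2 : β.1 ∈ L := by_contra fun h2 => right_ne_zero_of_mul h (hg0 _ h2)
      exact hγ ⟨(γ * β.1⁻¹, β.1), ⟨⟨h1, h2⟩, src_mul_inv β.2.symm⟩, mul_inv_mul β.2.symm⟩
  · intro γ hγ
    exact ⟨_, hγ.2, _, (hb γ hγ.1).1, (hWeq γ hγ).1, (hWeq γ hγ).2, hval γ hγ.1⟩

theorem conv_mem {f g : G → ℂ} (hf : f ∈ ccSpan G) (hg : g ∈ ccSpan G) : conv f g ∈ ccSpan G := by
  have hf' := hf
  rw [ccSpan_eq_span_bisection] at hf'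
  induction hf' using Submodule.span_induction with
  | mem f h =>
    have hg' := hg
    rw [ccSpan_eq_span_bisection] at hg'
    induction hg' using Submodule.span_induction with
    | mem g h2 =>
      obtain ⟨U, hU, hUb, hfU⟩ := h
      obtain ⟨V, hV, hVb, hgV⟩ := h2
      obtain ⟨W, hW, hWb, hc, -⟩ := conv_bisection hU hUb hV hVb hfU hgV
      exact bisectionFns_subset ⟨W, hW, hWb, hc⟩
    | zero => rw [conv_zero_right]; exact Submodule.zero_mem _
    | add g1 g2 h1 h2 ih1 ih2 =>
      rw [← ccSpan_eq_span_bisection] at h1 h2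
      rw [conv_add_right (finiteOnFibers hf)]
      exact Submodule.add_mem _ (ih1 h1) (ih2 h2)
    | smul c g h2 ih =>
      rw [← ccSpan_eq_span_bisection] at h2
      rw [conv_smul_right]
      exact Submodule.smul_mem _ _ (ih h2)
  | zero => rw [conv_zero_left]; exact Submodule.zero_mem _
  | add f1 f2 h1 h2 ih1 ih2 =>
    rw [← ccSpan_eq_span_bisection] at h1 h2
    rw [conv_add_left (finiteOnFibers h1) (finiteOnFibers h2)]
    exact Submodule.add_mem _ (ih1 h1) (ih2 h2)
  | smul c f h2 ih =>
    rw [← ccSpan_eq_span_bisection] at h2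
    rw [conv_smul_left]
    exact Submodule.smul_mem _ _ (ih h2)

end Functions

section StarAlgebra

/-- `𝒞(G)` as a *-algebra under convolution. -/
def CcAlg (G : Type u) [TopologicalSpace G] [SetGroupoid G] : Type u := ↥(ccSpan G)

variable {G : Type u} [TopologicalSpace G] [SetGroupoid G]

noncomputable instance : AddCommGroup (CcAlg G) := inferInstanceAs (AddCommGroup ↥(ccSpan G))
noncomputable instance : Module ℂ (CcAlg G) := inferInstanceAs (Module ℂ ↥(ccSpan G))

/-- The function underlying an element of `𝒞(G)`. -/
def CcAlg.toFn (f : CcAlg G) : G → ℂ := f.1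

theorem CcAlg.ext {f g : CcAlg G} (h : f.toFn = g.toFn) : f = g := Subtype.ext h

variable [IsEtaleGroupoid G]

noncomputable instance : Mul (CcAlg G) := ⟨fun f g => ⟨conv f.toFn g.toFn, conv_mem f.2 g.2⟩⟩
noncomputable instance : Star (CcAlg G) := ⟨fun f => ⟨invol f.toFn, invol_mem f.2⟩⟩

theorem CcAlg.toFn_mul (f g : CcAlg G) : (f * g).toFn = conv f.toFn g.toFn := rfl
theorem CcAlg.toFn_star (f : CcAlg G) : (star f).toFn = invol f.toFn := rfl

noncomputable instance : NonUnitalRing (CcAlg G) :=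
  { (inferInstance : AddCommGroup (CcAlg G)), (inferInstance : Mul (CcAlg G)) with
    left_distrib := fun f _ _ => CcAlg.ext (conv_add_right (finiteOnFibers f.2) _ _)
    right_distrib := fun f g _ =>
      CcAlg.ext (conv_add_left (finiteOnFibers f.2) (finiteOnFibers g.2) _)
    zero_mul := fun _ => CcAlg.ext (conv_zero_left _)
    mul_zero := fun _ => CcAlg.ext (conv_zero_right _)
    mul_assoc := fun f g _ =>
      CcAlg.ext (conv_assoc (finiteOnFibers f.2) (finiteOnFibers g.2) _) }

noncomputable instance : IsScalarTower ℂ (CcAlg G) (CcAlg G) :=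
  ⟨fun c _ _ => CcAlg.ext (conv_smul_left c _ _)⟩

noncomputable instance : SMulCommClass ℂ (CcAlg G) (CcAlg G) :=
  ⟨fun c _ _ => CcAlg.ext (conv_smul_right c _ _).symm⟩

noncomputable instance : StarRing (CcAlg G) where
  star_involutive _ := CcAlg.ext (invol_invol _)
  star_mul _ _ := CcAlg.ext (invol_conv _ _)
  star_add _ _ := CcAlg.ext (invol_add _ _)

noncomputable instance : StarModule ℂ (CcAlg G) where
  star_smul c _ := CcAlg.ext (invol_smul c _)

end StarAlgebra

section UniversalNorm

variable {G : Type u} [TopologicalSpace G] [SetGroupoid G] [IsEtaleGroupoid G]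

/-- On `C_c(W)`, `W ⊆ G⁽⁰⁾`, every representation is bounded by the supremum norm. -/
theorem norm_le_of_units {W : Set G} (hW : IsOpen W) (hWb : IsBisection W)
    (hWu : W ⊆ (units : Set G)) (h : CcAlg G) (hh : h.toFn ∈ CcOn W)
    (hreal : ∀ γ, conj (h.toFn γ) = h.toFn γ) {C : ℝ} (hC0 : 0 ≤ C) (hC : ∀ γ, ‖h.toFn γ‖ ≤ C)
    {H : Type u} [NormedAddCommGroup H] [InnerProductSpace ℂ H] [CompleteSpace H]
    (ρ : CcAlg G →⋆ₙₐ[ℂ] (H →L[ℂ] H)) : ‖ρ h‖ ≤ C := by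
  obtain ⟨hc, K, hKW, hK, h0⟩ := hh
  have hu : ∀ γ, γ ∉ (units : Set G) → h.toFn γ = 0 := fun γ hγ =>
    h0 γ fun h2 => hγ (hWu (hKW h2))
  have hsa : star h = h := by
    refine CcAlg.ext ?_
    rw [CcAlg.toFn_star]
    funext γ
    by_cases hγ : γ ∈ (units : Set G)
    · rw [invol, inv_of_unit hγ, hreal]
    · have : γ⁻¹ ∉ (units : Set G) := fun h2 => hγ (by
        have := inv_of_unit h2
        rw [inv_inv'] at this
        rwa [← this] at h2)
      rw [invol, hu _ this, hu _ hγ, map_zero]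
  have hT : IsSelfAdjoint (ρ h) := by
    rw [IsSelfAdjoint, ← map_star, hsa]
  -- if `‖z‖ > C`, then `z - ρ(h)` has the inverse `z⁻¹ (1 + ρ(k))` with `k = h / (z - h)`
  have key : ∀ z : ℂ, C < ‖z‖ → z ∉ spectrum ℂ (ρ h) := by
    intro z hz
    have hz0 : z ≠ 0 := norm_pos_iff.1 (hC0.trans_lt hz)
    have hne : ∀ γ, z - h.toFn γ ≠ 0 := by
      intro γ h2
      rw [sub_eq_zero] at h2
      exact absurd (hC γ) (by rw [← h2]; exact not_le.2 hz)
    let kf : G → ℂ := fun γ => h.toFn γ / (z - h.toFn γ)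
    have hkc : kf ∈ CcOn W :=
      ⟨hc.div (continuousOn_const.sub hc) fun γ _ => hne γ, K, hKW, hK, fun γ hγ => by
        simp [kf, h0 γ hγ]⟩
    let k : CcAlg G := ⟨kf, bisectionFns_subset ⟨W, hW, hWb, hkc⟩⟩
    have hku : ∀ γ, γ ∉ (units : Set G) → k.toFn γ = 0 := fun γ hγ => by
      change kf γ = 0
      simp [kf, hu γ hγ]
    have e1 : z • k - h - h * k = 0 := by
      refine CcAlg.ext (funext fun γ => ?_)
      change z * kf γ - h.toFn γ - conv h.toFn k.toFn γ = 0
      rw [conv_of_units hu hku]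
      change z * kf γ - h.toFn γ - h.toFn γ * kf γ = 0
      simp only [kf]
      field_simp [hne γ]
      ring
    have e2 : z • k - h - k * h = 0 := by
      have : k * h = h * k := by
        refine CcAlg.ext (funext fun γ => ?_)
        rw [CcAlg.toFn_mul, CcAlg.toFn_mul, conv_of_units hu hku, conv_of_units hku hu]
        exact mul_comm _ _
      rw [this, e1]
    have f1 := congrArg ρ e1
    have f2 := congrArg ρ e2
    simp only [map_sub, map_smul, map_mul, map_zero] at f1 f2
    rw [spectrum.notMem_iff, Algebra.algebraMap_eq_smul_one, isUnit_iff_exists]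
    refine ⟨z⁻¹ • (1 + ρ k), ?_, ?_⟩
    · have : (z • (1 : H →L[ℂ] H) - ρ h) * (z⁻¹ • (1 + ρ k))
          = 1 + z⁻¹ • (z • ρ k - ρ h - ρ h * ρ k) := by
        simp only [mul_smul_comm, sub_mul, smul_mul_assoc, one_mul, mul_add, mul_one, smul_sub,
          smul_add, smul_smul, inv_mul_cancel₀ hz0, one_smul]
        abel
      rw [this, f1, smul_zero, add_zero]
    · have : (z⁻¹ • (1 + ρ k)) * (z • (1 : H →L[ℂ] H) - ρ h)
          = 1 + z⁻¹ • (z • ρ k - ρ h - ρ k * ρ h) := by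
        simp only [mul_smul_comm, mul_sub, smul_mul_assoc, one_mul, add_mul, mul_one, smul_sub,
          smul_add, smul_smul, inv_mul_cancel₀ hz0, mul_inv_cancel₀ hz0,
          one_smul]
        abel
      rw [this, f2, smul_zero, add_zero]
  have hr : spectralRadius ℂ (ρ h) ≤ ENNReal.ofReal C := by
    refine iSup₂_le fun z hz => ?_
    rw [← enorm_eq_nnnorm, ← ofReal_norm]
    refine ENNReal.ofReal_le_ofReal (not_lt.1 fun h2 => key z h2 hz)
  rw [hT.spectralRadius_eq_nnnorm] at hr
  have := ENNReal.toReal_mono ENNReal.ofReal_ne_top hr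
  rwa [ENNReal.toReal_ofReal hC0] at this

theorem exists_bound_bisection {f : CcAlg G} (hf : f.toFn ∈ bisectionFns G) :
    ∃ C : ℝ, ∀ (H : Type u) [NormedAddCommGroup H] [InnerProductSpace ℂ H] [CompleteSpace H]
      (ρ : CcAlg G →⋆ₙₐ[ℂ] (H →L[ℂ] H)), ‖ρ f‖ ≤ C := by
  obtain ⟨U, hU, hUb, hfU⟩ := hf
  have hbd : ∃ M : ℝ, 0 ≤ M ∧ ∀ γ, ‖f.toFn γ‖ ≤ M := by
    obtain ⟨hc, K, hKU, hK, h0⟩ := hfU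
    obtain ⟨M, hM⟩ := hK.exists_bound_of_continuousOn (hc.mono hKU)
    refine ⟨max M 0, le_max_right _ _, fun γ => ?_⟩
    by_cases hγ : γ ∈ K
    · exact (hM γ hγ).trans (le_max_left _ _)
    · rw [h0 γ hγ, norm_zero]; exact le_max_right _ _
  obtain ⟨M, hM0, hM⟩ := hbd
  have hinvU : IsOpen ((fun γ : G => γ⁻¹) ⁻¹' U) := hU.preimage continuous_inv
  have hinvb : IsBisection ((fun γ : G => γ⁻¹) ⁻¹' U) := by
    constructor
    · intro α hα β hβ h
      have : α⁻¹ = β⁻¹ := hUb.2 hα hβ (by rw [rng_inv, rng_inv, h])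
      rw [← inv_inv' α, this, inv_inv']
    · intro α hα β hβ h
      have : α⁻¹ = β⁻¹ := hUb.1 hα hβ (by rw [src_inv, src_inv, h])
      rw [← inv_inv' α, this, inv_inv']
  have hinvf : invol f.toFn ∈ CcOn ((fun γ : G => γ⁻¹) ⁻¹' U) := by
    obtain ⟨hc, K, hKU, hK, h0⟩ := hfU
    refine ⟨Complex.continuous_conj.comp_continuousOn
        (hc.comp continuous_inv.continuousOn fun γ h => h), (fun γ => γ⁻¹) '' K, ?_,
        hK.image continuous_inv, ?_⟩
    · rintro _ ⟨γ, hγ, rfl⟩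
      simpa [inv_inv'] using hKU hγ
    · intro γ hγ
      have : f.toFn γ⁻¹ = 0 := h0 _ fun h => hγ ⟨_, h, inv_inv' γ⟩
      simp [invol, this]
  obtain ⟨W, hW, hWb, hcW, hval⟩ := conv_bisection hinvU hinvb hU hUb hinvf hfU
  have hval' : ∀ γ ∈ W, γ ∈ (units : Set G) ∧
      ∃ β, conv (invol f.toFn) f.toFn γ = conj (f.toFn β) * f.toFn β := by
    intro γ hγ
    obtain ⟨α, hα, β, hβ, hs, rfl, he⟩ := hval γ hγ
    have : α⁻¹ = β := hUb.2 hα hβ (by rw [rng_inv, hs])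
    subst this
    refine ⟨?_, α⁻¹, by rw [he]; rfl⟩
    rw [mul_inv_self]
    exact rng_mem _
  have hall : ∀ γ, ∃ t : ℝ, |t| ≤ M * M ∧ (star f * f).toFn γ = t := by
    intro γ
    by_cases hγ : γ ∈ W
    · obtain ⟨-, β, hβ⟩ := hval' γ hγ
      refine ⟨‖f.toFn β‖ * ‖f.toFn β‖, ?_, ?_⟩
      · rw [abs_of_nonneg (by positivity)]
        exact mul_le_mul (hM β) (hM β) (norm_nonneg _) hM0
      · change conv (invol f.toFn) f.toFn γ = _
        rw [hβ, mul_comm, Complex.mul_conj, Complex.normSq_eq_norm_sq]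
        push_cast
        ring
    · obtain ⟨-, K, hKW, -, h0⟩ := hcW
      refine ⟨0, by simpa using by positivity, ?_⟩
      rw [Complex.ofReal_zero]
      exact h0 γ fun h => hγ (hKW h)
  refine ⟨M, fun H _ _ _ ρ => ?_⟩
  have h1 : ‖ρ (star f * f)‖ ≤ M * M := by
    refine norm_le_of_units hW hWb (fun γ hγ => (hval' γ hγ).1) (star f * f) hcW ?_
      (by positivity) ?_ ρ
    · intro γ
      obtain ⟨t, -, ht⟩ := hall γ
      rw [ht, Complex.conj_ofReal]
    · intro γ
      obtain ⟨t, ht', ht⟩ := hall γ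
      rwa [ht, Complex.norm_real]
  rw [map_mul, map_star, CStarRing.norm_star_mul_self] at h1
  exact le_of_not_gt fun h2 => absurd h1 (not_le.2 (mul_self_lt_mul_self hM0 h2))

end UniversalNorm

section UniversalNorm2

variable {G : Type u} [TopologicalSpace G] [SetGroupoid G] [IsEtaleGroupoid G]

/-- The norms `‖ρ(f)‖`, for `ρ` a *-representation of `𝒞(G)` on a Hilbert space. -/
def repNorms (f : CcAlg G) : Set ℝ :=
  {r | ∃ (H : Type u) (_ : NormedAddCommGroup H) (_ : InnerProductSpace ℂ H) (_ : CompleteSpace H)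
    (ρ : CcAlg G →⋆ₙₐ[ℂ] (H →L[ℂ] H)), r = ‖ρ f‖}

/-- The universal norm on `𝒞(G)`. -/
noncomputable def universalNorm (f : CcAlg G) : ℝ := sSup (repNorms f)

theorem exists_bound (f : CcAlg G) :
    ∃ C : ℝ, ∀ (H : Type u) [NormedAddCommGroup H] [InnerProductSpace ℂ H] [CompleteSpace H]
      (ρ : CcAlg G →⋆ₙₐ[ℂ] (H →L[ℂ] H)), ‖ρ f‖ ≤ C := by
  obtain ⟨f, hf⟩ := f
  have hf' := hf
  rw [ccSpan_eq_span_bisection] at hf'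
  induction hf' using Submodule.span_induction with
  | mem f h => exact exists_bound_bisection (f := (⟨f, hf⟩ : CcAlg G)) h
  | zero =>
    refine ⟨0, fun H _ _ _ ρ => ?_⟩
    change ‖ρ 0‖ ≤ 0
    rw [map_zero, norm_zero]
  | add f g h1 h2 ih1 ih2 =>
    rw [← ccSpan_eq_span_bisection] at h1 h2
    obtain ⟨C, hC⟩ := ih1 h1
    obtain ⟨D, hD⟩ := ih2 h2
    refine ⟨C + D, fun H _ _ _ ρ => ?_⟩
    let a : CcAlg G := ⟨f, h1⟩
    let b : CcAlg G := ⟨g, h2⟩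
    change ‖ρ (a + b)‖ ≤ _
    rw [map_add]
    exact (norm_add_le _ _).trans (add_le_add (hC H ρ) (hD H ρ))
  | smul c f h1 ih =>
    rw [← ccSpan_eq_span_bisection] at h1
    obtain ⟨C, hC⟩ := ih h1
    refine ⟨‖c‖ * C, fun H _ _ _ ρ => ?_⟩
    let a : CcAlg G := ⟨f, h1⟩
    change ‖ρ (c • a)‖ ≤ _
    rw [map_smul, norm_smul]
    exact mul_le_mul_of_nonneg_left (hC H ρ) (norm_nonneg _)

theorem repNorms_bddAbove (f : CcAlg G) : BddAbove (repNorms f) := by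
  obtain ⟨C, hC⟩ := exists_bound f
  refine ⟨C, ?_⟩
  rintro _ ⟨H, _, _, _, ρ, rfl⟩
  exact hC H ρ

theorem repNorms_nonempty (f : CcAlg G) : (repNorms f).Nonempty :=
  ⟨_, lp (fun _ : G => ℂ) 2, inferInstance, inferInstance, inferInstance, 0, rfl⟩

theorem norm_rep_le (f : CcAlg G) {H : Type u} [NormedAddCommGroup H] [InnerProductSpace ℂ H]
    [CompleteSpace H] (ρ : CcAlg G →⋆ₙₐ[ℂ] (H →L[ℂ] H)) : ‖ρ f‖ ≤ universalNorm f :=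
  le_csSup (repNorms_bddAbove f) ⟨H, _, _, _, ρ, rfl⟩

theorem universalNorm_le {f : CcAlg G} {C : ℝ}
    (h : ∀ (H : Type u) [NormedAddCommGroup H] [InnerProductSpace ℂ H] [CompleteSpace H]
      (ρ : CcAlg G →⋆ₙₐ[ℂ] (H →L[ℂ] H)), ‖ρ f‖ ≤ C) : universalNorm f ≤ C := by
  refine csSup_le (repNorms_nonempty f) ?_
  rintro _ ⟨H, _, _, _, ρ, rfl⟩
  exact h H ρ

theorem universalNorm_nonneg (f : CcAlg G) : 0 ≤ universalNorm f :=
  (norm_nonneg _).trans (norm_rep_le f (0 : CcAlg G →⋆ₙₐ[ℂ]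
    (lp (fun _ : G => ℂ) 2 →L[ℂ] lp (fun _ : G => ℂ) 2)))

theorem universalNorm_zero : universalNorm (0 : CcAlg G) = 0 :=
  le_antisymm (universalNorm_le fun H _ _ _ ρ => by rw [map_zero, norm_zero])
    (universalNorm_nonneg _)

theorem universalNorm_add_le (f g : CcAlg G) :
    universalNorm (f + g) ≤ universalNorm f + universalNorm g :=
  universalNorm_le fun H _ _ _ ρ => by
    rw [map_add]
    exact (norm_add_le _ _).trans (add_le_add (norm_rep_le f ρ) (norm_rep_le g ρ))

theorem universalNorm_mul_le (f g : CcAlg G) :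
    universalNorm (f * g) ≤ universalNorm f * universalNorm g :=
  universalNorm_le fun H _ _ _ ρ => by
    rw [map_mul]
    exact (norm_mul_le _ _).trans (mul_le_mul (norm_rep_le f ρ) (norm_rep_le g ρ)
      (norm_nonneg _) (universalNorm_nonneg _))

theorem universalNorm_smul_le (c : ℂ) (f : CcAlg G) :
    universalNorm (c • f) ≤ ‖c‖ * universalNorm f :=
  universalNorm_le fun H _ _ _ ρ => by
    rw [map_smul, norm_smul]
    exact mul_le_mul_of_nonneg_left (norm_rep_le f ρ) (norm_nonneg _)

theorem universalNorm_neg (f : CcAlg G) : universalNorm (-f) = universalNorm f := by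
  refine le_antisymm ?_ ?_ <;> refine universalNorm_le fun H _ _ _ ρ => ?_
  · rw [map_neg, norm_neg]; exact norm_rep_le f ρ
  · rw [← norm_neg, ← map_neg]; exact norm_rep_le (-f) ρ

theorem universalNorm_star (f : CcAlg G) : universalNorm (star f) = universalNorm f := by
  refine le_antisymm ?_ ?_ <;> refine universalNorm_le fun H _ _ _ ρ => ?_
  · rw [map_star, norm_star]; exact norm_rep_le f ρ
  · rw [← norm_star, ← map_star]; exact norm_rep_le (star f) ρ

theorem universalNorm_mul_self_le (f : CcAlg G) :
    universalNorm f * universalNorm f ≤ universalNorm (star f * f) := by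
  have h : universalNorm f ≤ √(universalNorm (star f * f)) :=
    universalNorm_le fun H _ _ _ ρ => by
      refine Real.le_sqrt_of_sq_le ?_
      rw [sq, ← CStarRing.norm_star_mul_self, ← map_star, ← map_mul]
      exact norm_rep_le _ ρ
  calc _ ≤ √(universalNorm (star f * f)) * √(universalNorm (star f * f)) :=
        mul_le_mul h h (universalNorm_nonneg _) (Real.sqrt_nonneg _)
    _ = _ := Real.mul_self_sqrt (universalNorm_nonneg _)

noncomputable instance : SeminormedAddCommGroup (CcAlg G) :=
  AddGroupSeminorm.toSeminormedAddCommGroup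
    { toFun := universalNorm
      map_zero' := universalNorm_zero
      add_le' := universalNorm_add_le
      neg' := universalNorm_neg }

noncomputable instance : NonUnitalSeminormedRing (CcAlg G) :=
  { (inferInstance : SeminormedAddCommGroup (CcAlg G)),
    (inferInstance : NonUnitalRing (CcAlg G)) with
    norm_mul_le := universalNorm_mul_le }

noncomputable instance : NormedSpace ℂ (CcAlg G) where
  norm_smul_le := universalNorm_smul_le

noncomputable instance : NormedStarGroup (CcAlg G) where
  norm_star_le f := (universalNorm_star f).le

end UniversalNorm2

section Completion

open UniformSpace

/-- The full groupoid C*-algebra `C*(G)`: the completion of `𝒞(G)` in the universal norm. -/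
def FullCStar (G : Type u) [TopologicalSpace G] [SetGroupoid G] [IsEtaleGroupoid G] : Type u :=
  Completion (CcAlg G)

variable {G : Type u} [TopologicalSpace G] [SetGroupoid G] [IsEtaleGroupoid G]

noncomputable instance : NormedAddCommGroup (FullCStar G) :=
  inferInstanceAs (NormedAddCommGroup (Completion (CcAlg G)))
noncomputable instance : NormedSpace ℂ (FullCStar G) :=
  inferInstanceAs (NormedSpace ℂ (Completion (CcAlg G)))
instance : CompleteSpace (FullCStar G) :=
  inferInstanceAs (CompleteSpace (Completion (CcAlg G)))

/-- The canonical map `𝒞(G) → C*(G)`. -/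
noncomputable def toFull : CcAlg G →L[ℂ] FullCStar G := Completion.toComplL

theorem isDenseInducing_toFull : IsDenseInducing (toFull : CcAlg G → FullCStar G) :=
  Completion.isDenseInducing_coe

theorem norm_toFull (f : CcAlg G) : ‖toFull f‖ = ‖f‖ := Completion.norm_coe f

theorem toFull_smul (c : ℂ) (f : CcAlg G) : toFull (c • f) = c • toFull f :=
  toFull.map_smul c f

theorem full_induction {p : FullCStar G → Prop} (a : FullCStar G) (hp : IsClosed {a | p a})
    (ih : ∀ f, p (toFull f)) : p a := Completion.induction_on a hp ih

/-- Multiplication and involution of `C*(G)` extend those of `𝒞(G)` by continuity. -/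
noncomputable instance : Mul (FullCStar G) :=
  ⟨Function.curry <| (isDenseInducing_toFull.prodMap isDenseInducing_toFull).extend
    (toFull ∘ Function.uncurry (· * ·))⟩

noncomputable instance : Star (FullCStar G) :=
  ⟨isDenseInducing_toFull.extend (fun f => toFull (star f))⟩

theorem toFull_mul (f g : CcAlg G) : toFull (f * g) = toFull f * toFull g :=
  ((isDenseInducing_toFull.prodMap isDenseInducing_toFull).extend_eq
    (toFull.continuous.comp continuous_mul) (f, g)).symm

theorem toFull_star (f : CcAlg G) : toFull (star f) = star (toFull f) :=
  (isDenseInducing_toFull.extend_eq (toFull.continuous.comp continuous_star) f).symm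

theorem full_continuous_mul : Continuous (fun p : FullCStar G × FullCStar G => p.1 * p.2) := by
  let m := (AddMonoidHom.mul : CcAlg G →+ CcAlg G →+ CcAlg G).compr₂
    (toFull : CcAlg G →L[ℂ] FullCStar G).toLinearMap.toAddMonoidHom
  have hm : Continuous fun p : CcAlg G × CcAlg G => m p.1 p.2 :=
    toFull.continuous.comp continuous_mul
  have di : IsDenseInducing
      ((toFull : CcAlg G →L[ℂ] FullCStar G).toLinearMap.toAddMonoidHom) := isDenseInducing_toFull
  exact di.extend_Z_bilin di hm

theorem full_continuous_star : Continuous (star : FullCStar G → FullCStar G) := by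
  refine uniformContinuous_uniformly_extend (e := (toFull : CcAlg G → FullCStar G))
    (Completion.isUniformInducing_coe _) isDenseInducing_toFull.dense
    (f := fun f => toFull (star f)) ?_ |>.continuous
  exact toFull.uniformContinuous.comp star_isometry.uniformContinuous

instance : ContinuousMul (FullCStar G) := ⟨full_continuous_mul⟩
instance : ContinuousStar (FullCStar G) := ⟨full_continuous_star⟩

theorem full_induction₂ {p : FullCStar G → FullCStar G → Prop} (a b : FullCStar G)
    (hp : IsClosed {q : FullCStar G × FullCStar G | p q.1 q.2})
    (ih : ∀ f g, p (toFull f) (toFull g)) : p a b := Completion.induction_on₂ a b hp ih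

theorem full_induction₃ {p : FullCStar G → FullCStar G → FullCStar G → Prop} (a b c : FullCStar G)
    (hp : IsClosed {q : FullCStar G × FullCStar G × FullCStar G | p q.1 q.2.1 q.2.2})
    (ih : ∀ f g h, p (toFull f) (toFull g) (toFull h)) : p a b c :=
  Completion.induction_on₃ a b c hp ih

noncomputable instance : NonUnitalNormedRing (FullCStar G) :=
  { (inferInstance : NormedAddCommGroup (FullCStar G)), (inferInstance : Mul (FullCStar G)) with
    left_distrib := fun a b c => by
      induction a, b, c using full_induction₃ with
      | hp => exact isClosed_eq (by fun_prop) (by fun_prop)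
      | ih f g h => rw [← map_add, ← toFull_mul, ← toFull_mul, ← toFull_mul, ← map_add, mul_add]
    right_distrib := fun a b c => by
      induction a, b, c using full_induction₃ with
      | hp => exact isClosed_eq (by fun_prop) (by fun_prop)
      | ih f g h => rw [← map_add, ← toFull_mul, ← toFull_mul, ← toFull_mul, ← map_add, add_mul]
    zero_mul := fun a => by
      induction a using full_induction with
      | hp => exact isClosed_eq (by fun_prop) (by fun_prop)
      | ih f => rw [← map_zero (toFull (G := G)), ← toFull_mul, zero_mul]
    mul_zero := fun a => by
      induction a using full_induction with
      | hp => exact isClosed_eq (by fun_prop) (by fun_prop)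
      | ih f => rw [← map_zero (toFull (G := G)), ← toFull_mul, mul_zero]
    mul_assoc := fun a b c => by
      induction a, b, c using full_induction₃ with
      | hp => exact isClosed_eq (by fun_prop) (by fun_prop)
      | ih f g h => rw [← toFull_mul, ← toFull_mul, ← toFull_mul, ← toFull_mul, mul_assoc]
    norm_mul_le := fun a b => by
      induction a, b using full_induction₂ with
      | hp => exact isClosed_le (by fun_prop) (by fun_prop)
      | ih f g =>
        rw [← toFull_mul, norm_toFull, norm_toFull, norm_toFull]
        exact norm_mul_le f g }

noncomputable instance : StarRing (FullCStar G) where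
  star_involutive a := by
    induction a using full_induction with
    | hp => exact isClosed_eq (by fun_prop) (by fun_prop)
    | ih f => rw [← toFull_star, ← toFull_star, star_star]
  star_mul a b := by
    induction a, b using full_induction₂ with
    | hp => exact isClosed_eq (by fun_prop) (by fun_prop)
    | ih f g =>
      rw [← toFull_mul, ← toFull_star, ← toFull_star, ← toFull_star, ← toFull_mul, star_mul]
  star_add a b := by
    induction a, b using full_induction₂ with
    | hp => exact isClosed_eq (by fun_prop) (by fun_prop)
    | ih f g =>
      rw [← map_add, ← toFull_star, ← toFull_star, ← toFull_star, ← map_add, star_add]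

noncomputable instance : NonUnitalCStarAlgebra (FullCStar G) where
  norm_mul_self_le a := by
    induction a using full_induction with
    | hp => exact isClosed_le (by fun_prop) (by fun_prop)
    | ih f =>
      rw [← toFull_star, ← toFull_mul, norm_toFull, norm_toFull]
      exact universalNorm_mul_self_le f
  complete := CompleteSpace.complete
  norm_smul_le := norm_smul_le
  smul_assoc c a b := by
    rw [smul_eq_mul, smul_eq_mul]
    induction a, b using full_induction₂ with
    | hp =>
      exact isClosed_eq (f := fun q : FullCStar G × FullCStar G => c • q.1 * q.2)
        (g := fun q => c • (q.1 * q.2)) ((continuous_fst.const_smul c).mul continuous_snd)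
        ((continuous_fst.mul continuous_snd).const_smul c)
    | ih f g =>
      rw [← toFull_smul, ← toFull_mul, ← toFull_mul, ← toFull_smul,
        smul_mul_assoc]
  smul_comm c a b := by
    rw [smul_eq_mul, smul_eq_mul]
    induction a, b using full_induction₂ with
    | hp =>
      exact isClosed_eq (f := fun q : FullCStar G × FullCStar G => c • (q.1 * q.2))
        (g := fun q => q.1 * c • q.2) ((continuous_fst.mul continuous_snd).const_smul c)
        (continuous_fst.mul (continuous_snd.const_smul c))
    | ih f g =>
      rw [← toFull_smul, ← toFull_mul, ← toFull_mul, ← toFull_smul,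
        mul_smul_comm]
  star_smul c a := by
    induction a using full_induction with
    | hp =>
      exact isClosed_eq (f := fun a : FullCStar G => star (c • a)) (g := fun a => star c • star a)
        (continuous_id.const_smul c).star (continuous_star.const_smul (star c))
    | ih f => rw [← toFull_smul, ← toFull_star, ← toFull_star, ← toFull_smul, star_smul]

section Extension

variable {H : Type u} [NormedAddCommGroup H] [InnerProductSpace ℂ H] [CompleteSpace H]

theorem uniformContinuous_rep (ρ : CcAlg G →⋆ₙₐ[ℂ] (H →L[ℂ] H)) : UniformContinuous ρ := by
  refine (AddMonoidHomClass.lipschitz_of_bound ρ 1 fun f => ?_).uniformContinuous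
  rw [one_mul]
  exact norm_rep_le f ρ

theorem extend_rep_coe (ρ : CcAlg G →⋆ₙₐ[ℂ] (H →L[ℂ] H)) (f : CcAlg G) :
    isDenseInducing_toFull.extend ρ (toFull f) = ρ f :=
  isDenseInducing_toFull.extend_eq (uniformContinuous_rep ρ).continuous f

theorem continuous_extend_rep (ρ : CcAlg G →⋆ₙₐ[ℂ] (H →L[ℂ] H)) :
    Continuous (isDenseInducing_toFull.extend ρ : FullCStar G → (H →L[ℂ] H)) :=
  (uniformContinuous_uniformly_extend (e := (toFull : CcAlg G → FullCStar G))
    (Completion.isUniformInducing_coe _) isDenseInducing_toFull.dense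
    (uniformContinuous_rep ρ)).continuous

/-- Every *-representation of `𝒞(G)` extends to `C*(G)`. -/
noncomputable def extendRep (ρ : CcAlg G →⋆ₙₐ[ℂ] (H →L[ℂ] H)) :
    FullCStar G →⋆ₙₐ[ℂ] (H →L[ℂ] H) where
  toFun := isDenseInducing_toFull.extend ρ
  map_smul' c a := by
    have := continuous_extend_rep ρ
    change isDenseInducing_toFull.extend ρ (c • a) = c • isDenseInducing_toFull.extend ρ a
    induction a using full_induction with
    | hp => exact isClosed_eq (this.comp (continuous_const_smul c)) (this.const_smul c)
    | ih f => rw [← toFull_smul, extend_rep_coe, extend_rep_coe]; exact map_smul ρ c f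
  map_zero' := by rw [← map_zero (toFull (G := G)), extend_rep_coe, map_zero]
  map_add' a b := by
    have := continuous_extend_rep ρ
    induction a, b using full_induction₂ with
    | hp => exact isClosed_eq (by fun_prop) (by fun_prop)
    | ih f g => rw [← map_add, extend_rep_coe, extend_rep_coe, extend_rep_coe, map_add]
  map_mul' a b := by
    have := continuous_extend_rep ρ
    induction a, b using full_induction₂ with
    | hp => exact isClosed_eq (by fun_prop) (by fun_prop)
    | ih f g => rw [← toFull_mul, extend_rep_coe, extend_rep_coe, extend_rep_coe, map_mul]
  map_star' a := by
    have := continuous_extend_rep ρ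
    induction a using full_induction with
    | hp => exact isClosed_eq (by fun_prop) (by fun_prop)
    | ih f => rw [← toFull_star, extend_rep_coe, extend_rep_coe, map_star]

end Extension

end Completion

section LeftRegular

variable {G : Type u} [TopologicalSpace G] [SetGroupoid G] [IsEtaleGroupoid G]

/-- The Hilbert space `ℓ²(G_x)`; it is of interest for units `x` and zero for other `x`. -/
abbrev L2Fiber (x : G) : Type u := lp (fun _ : Fiber x => ℂ) 2

/-- The delta function at `γ ∈ G_x`. -/
noncomputable def delta {x : G} (γ : Fiber x) : L2Fiber x := by
  classical exact lp.single 2 γ (1 : ℂ)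

theorem leftAct_bound_bisection (x : G) {f : G → ℂ} (hf : f ∈ bisectionFns G) :
    ∃ C : ℝ, 0 ≤ C ∧ ∀ ξ : L2Fiber x, ∃ η : L2Fiber x,
      (∀ γ, η γ = leftAct x f ξ γ) ∧ ‖η‖ ≤ C * ‖ξ‖ := by
  obtain ⟨U, -, hUb, hc, K, hKU, hK, h0⟩ := hf
  have hfU : ∀ γ, f γ ≠ 0 → γ ∈ U := fun γ h => hKU (by_contra fun h2 => h (h0 γ h2))
  obtain ⟨M, hM0, hM⟩ : ∃ M : ℝ, 0 ≤ M ∧ ∀ γ, ‖f γ‖ ≤ M := by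
    obtain ⟨M, hM⟩ := hK.exists_bound_of_continuousOn (hc.mono hKU)
    refine ⟨max M 0, le_max_right _ _, fun γ => ?_⟩
    by_cases hγ : γ ∈ K
    · exact (hM γ hγ).trans (le_max_left _ _)
    · rw [h0 γ hγ, norm_zero]; exact le_max_right _ _
  refine ⟨M, hM0, fun ξ => ?_⟩
  have hp : 0 < (2 : ℝ≥0∞).toReal := by norm_num
  have hsum : ∀ s : Finset (Fiber x),
      ∑ γ ∈ s, ‖leftAct x f ξ γ‖ ^ (2 : ℝ≥0∞).toReal ≤ (M * ‖ξ‖) ^ (2 : ℝ≥0∞).toReal := by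
    intro s
    classical
    let s' := s.filter fun γ => leftAct x f ξ γ ≠ 0
    have hex : ∀ γ : Fiber x, ∃ β : Fiber x, leftAct x f ξ γ ≠ 0 →
        γ.1 * β.1⁻¹ ∈ U ∧ ‖leftAct x f ξ γ‖ ≤ M * ‖ξ β‖ := by
      intro γ
      by_cases h : leftAct x f ξ γ = 0
      · exact ⟨γ, fun h2 => absurd h h2⟩
      · obtain ⟨β, hβ⟩ : ∃ β : Fiber x, f (γ.1 * β.1⁻¹) * ξ β ≠ 0 := by
          by_contra! h2
          exact h (finsum_eq_zero_of_forall_eq_zero h2)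
        have hβU := hfU _ (left_ne_zero_of_mul hβ)
        refine ⟨β, fun _ => ⟨hβU, ?_⟩⟩
        have : leftAct x f ξ γ = f (γ.1 * β.1⁻¹) * ξ β := by
          refine finsum_eq_single _ β fun δ hδ => ?_
          by_contra h3
          have hδU := hfU _ (left_ne_zero_of_mul h3)
          have h4 := γ.2.trans β.2.symm
          have h5 := γ.2.trans δ.2.symm
          refine hδ (Subtype.ext (mul_inv_left_cancel h5 h4 (hUb.2 hδU hβU ?_)))
          rw [rng_mul_inv h4, rng_mul_inv h5]
        rw [this, norm_mul]
        exact mul_le_mul_of_nonneg_right (hM _) (norm_nonneg _)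
    choose φ hφ using hex
    have hinj : Set.InjOn φ s' := by
      intro γ hγ δ hδ h
      have h1 := (hφ γ (Finset.mem_filter.1 hγ).2).1
      have h2 := (hφ δ (Finset.mem_filter.1 hδ).2).1
      rw [← h] at h2
      have h3 := γ.2.trans (φ γ).2.symm
      have h4 := δ.2.trans (φ γ).2.symm
      refine Subtype.ext (mul_inv_right_cancel h3 h4 (hUb.1 h1 h2 ?_))
      rw [src_mul_inv h3, src_mul_inv h4]
    calc ∑ γ ∈ s, ‖leftAct x f ξ γ‖ ^ (2 : ℝ≥0∞).toReal
        = ∑ γ ∈ s', ‖leftAct x f ξ γ‖ ^ (2 : ℝ≥0∞).toReal := by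
          refine (Finset.sum_filter_of_ne fun γ _ h => ?_).symm
          intro h2
          simp [h2] at h
      _ ≤ ∑ γ ∈ s', M ^ (2 : ℝ≥0∞).toReal * ‖ξ (φ γ)‖ ^ (2 : ℝ≥0∞).toReal := by
          refine Finset.sum_le_sum fun γ hγ => ?_
          rw [← Real.mul_rpow hM0 (norm_nonneg _)]
          exact Real.rpow_le_rpow (norm_nonneg _) (hφ γ (Finset.mem_filter.1 hγ).2).2 hp.le
      _ = M ^ (2 : ℝ≥0∞).toReal * ∑ β ∈ s'.image φ, ‖ξ β‖ ^ (2 : ℝ≥0∞).toReal := by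
          rw [← Finset.mul_sum, Finset.sum_image hinj]
      _ ≤ M ^ (2 : ℝ≥0∞).toReal * ‖ξ‖ ^ (2 : ℝ≥0∞).toReal :=
          mul_le_mul_of_nonneg_left (lp.sum_rpow_le_norm_rpow hp ξ _) (by positivity)
      _ = _ := (Real.mul_rpow hM0 (norm_nonneg _)).symm
  refine ⟨⟨leftAct x f ξ, memℓp_gen' hsum⟩, fun γ => rfl, ?_⟩
  exact lp.norm_le_of_forall_sum_le hp (by positivity) hsum

theorem leftAct_bound (x : G) {f : G → ℂ} (hf : f ∈ ccSpan G) :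
    ∃ C : ℝ, 0 ≤ C ∧ ∀ ξ : L2Fiber x, ∃ η : L2Fiber x,
      (∀ γ, η γ = leftAct x f ξ γ) ∧ ‖η‖ ≤ C * ‖ξ‖ := by
  rw [ccSpan_eq_span_bisection] at hf
  induction hf using Submodule.span_induction with
  | mem f h => exact leftAct_bound_bisection x h
  | zero =>
    refine ⟨0, le_rfl, fun ξ => ⟨0, fun γ => ?_, by simp⟩⟩
    simp [leftAct]
  | add f g h1 h2 ih1 ih2 =>
    rw [← ccSpan_eq_span_bisection] at h1 h2
    obtain ⟨C, hC0, hC⟩ := ih1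
    obtain ⟨D, hD0, hD⟩ := ih2
    refine ⟨C + D, add_nonneg hC0 hD0, fun ξ => ?_⟩
    obtain ⟨η, hη, hη'⟩ := hC ξ
    obtain ⟨ζ, hζ, hζ'⟩ := hD ξ
    refine ⟨η + ζ, fun γ => ?_, ?_⟩
    · rw [lp.coeFn_add, Pi.add_apply, hη, hζ,
        leftAct_add_left (finiteOnFibers h1) (finiteOnFibers h2)]
      rfl
    · rw [add_mul]
      exact (norm_add_le _ _).trans (add_le_add hη' hζ')
  | smul c f h ih =>
    obtain ⟨C, hC0, hC⟩ := ih
    refine ⟨‖c‖ * C, by positivity, fun ξ => ?_⟩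
    obtain ⟨η, hη, hη'⟩ := hC ξ
    refine ⟨c • η, fun γ => ?_, ?_⟩
    · rw [lp.coeFn_smul, Pi.smul_apply, hη, leftAct_smul_left]
      rfl
    · rw [norm_smul, mul_assoc]
      exact mul_le_mul_of_nonneg_left hη' (norm_nonneg _)

theorem leftAct_memℓp (x : G) (f : CcAlg G) (ξ : L2Fiber x) :
    Memℓp (leftAct x f.toFn (fun β => ξ β)) 2 := by
  obtain ⟨C, -, hC⟩ := leftAct_bound x f.2
  obtain ⟨η, hη, -⟩ := hC ξ
  have : (fun γ => η γ) = leftAct x f.toFn (fun β => ξ β) := funext hη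
  exact this ▸ η.2

/-- The operator `λ_x(f)` on `ℓ²(G_x)`: `(λ_x(f) ξ)(γ) = ∑_{β ∈ G_x} f(γβ⁻¹) ξ(β)`. -/
noncomputable def leftRegOp (x : G) (f : CcAlg G) : L2Fiber x →L[ℂ] L2Fiber x :=
  LinearMap.mkContinuousOfExistsBound
    { toFun := fun ξ => ⟨leftAct x f.toFn (fun β => ξ β), leftAct_memℓp x f ξ⟩
      map_add' := fun ξ η =>
        lp.ext (leftAct_add_right (finiteOnFibers f.2) x (fun β => ξ β) (fun β => η β))
      map_smul' := fun c ξ => lp.ext (leftAct_smul_right c f.toFn x (fun β => ξ β)) }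
    (by
      obtain ⟨C, -, hC⟩ := leftAct_bound x f.2
      refine ⟨C, fun ξ => ?_⟩
      obtain ⟨η, hη, hη'⟩ := hC ξ
      refine le_of_eq_of_le (congrArg norm ?_) hη'
      exact lp.ext (funext fun γ => (hη γ).symm))

theorem leftRegOp_apply (x : G) (f : CcAlg G) (ξ : L2Fiber x) (γ : Fiber x) :
    leftRegOp x f ξ γ = leftAct x f.toFn (fun β => ξ β) γ := rfl

theorem leftRegOp_delta (x : G) (f : CcAlg G) (β γ : Fiber x) :
    leftRegOp x f (delta β) γ = f.toFn (γ.1 * β.1⁻¹) := by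
  classical
  rw [leftRegOp_apply, leftAct, finsum_eq_single _ β]
  · simp [delta, lp.single_apply]
  · intro δ hδ
    simp [delta, lp.single_apply, hδ]

theorem inner_delta {x : G} (γ : Fiber x) (ξ : L2Fiber x) : inner ℂ (delta γ) ξ = ξ γ := by
  classical
  simp [delta, lp.inner_single_left]

theorem clm_ext_delta {x : G} {S T : L2Fiber x →L[ℂ] L2Fiber x}
    (h : ∀ β γ : Fiber x, S (delta β) γ = T (delta β) γ) : S = T := by
  classical
  refine ContinuousLinearMap.ext fun ξ => ?_
  have hs := lp.hasSum_single (p := 2) (by norm_num) ξ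
  have e : ∀ β, S (lp.single 2 β (ξ β)) = T (lp.single 2 β (ξ β)) := by
    intro β
    have h1 : lp.single (E := fun _ : Fiber x => ℂ) 2 β (ξ β) = ξ β • delta β := by
      simp [delta, ← lp.single_smul]
    rw [h1, map_smul, map_smul, lp.ext (funext (h β))]
  have h1 := hs.mapL S
  have h2 := hs.mapL T
  simp only [e] at h1
  exact h1.unique h2

/-- The left regular representation `λ_x` of `𝒞(G)` on `ℓ²(G_x)`. -/
noncomputable def leftReg (x : G) : CcAlg G →⋆ₙₐ[ℂ] (L2Fiber x →L[ℂ] L2Fiber x) where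
  toFun := leftRegOp x
  map_smul' c f := clm_ext_delta fun β γ => by
    rw [leftRegOp_delta]
    change _ = c • leftRegOp x f (delta β) γ
    rw [leftRegOp_delta]
    rfl
  map_zero' := clm_ext_delta fun β γ => by
    rw [leftRegOp_delta]
    rfl
  map_add' f g := clm_ext_delta fun β γ => by
    rw [leftRegOp_delta]
    change _ = leftRegOp x f (delta β) γ + leftRegOp x g (delta β) γ
    rw [leftRegOp_delta, leftRegOp_delta]
    rfl
  map_mul' f g := clm_ext_delta fun β γ => by
    change leftRegOp x (f * g) (delta β) γ = leftRegOp x f (leftRegOp x g (delta β)) γ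
    exact congrFun (leftAct_conv (finiteOnFibers f.2) (finiteOnFibers g.2) x
      (fun δ => (delta β : L2Fiber x) δ)) γ
  map_star' f := clm_ext_delta fun β γ => by
    rw [leftRegOp_delta, ← inner_delta γ, ContinuousLinearMap.star_eq_adjoint,
      ContinuousLinearMap.adjoint_inner_right, ← inner_conj_symm, inner_delta, leftRegOp_delta,
      CcAlg.toFn_star, invol, mul_inv_inv (γ.2.trans β.2.symm)]

/-- The left regular representation `λ_x` of `C*(G)` on `ℓ²(G_x)`. -/
noncomputable def leftRegFull (x : G) : FullCStar G →⋆ₙₐ[ℂ] (L2Fiber x →L[ℂ] L2Fiber x) :=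
  extendRep (leftReg x)

end LeftRegular

section Main

/-- The copy of `C₀(G⁽⁰⁾)` in `C*(G)`: the closure of the image of `C_c(G⁽⁰⁾) ⊆ 𝒞(G)`. (On
`C_c(G⁽⁰⁾)` the universal norm is the supremum norm.) -/
def diagonal (G : Type u) [TopologicalSpace G] [SetGroupoid G] [IsEtaleGroupoid G] :
    Set (FullCStar G) :=
  closure (toFull '' {f : CcAlg G | f.toFn ∈ CcOn (units : Set G)})

/-- Every nonzero closed two-sided ideal `I` of `C*(G)` satisfies `I ∩ C₀(G⁽⁰⁾) ≠ {0}`. -/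
def FullUniqueness (G : Type u) [TopologicalSpace G] [SetGroupoid G] [IsEtaleGroupoid G] : Prop :=
  ∀ I : TwoSidedIdeal (FullCStar G), IsClosed (I : Set (FullCStar G)) → I ≠ ⊥ →
    (I : Set (FullCStar G)) ∩ diagonal G ≠ {0}

variable {G : Type u} [TopologicalSpace G] [SetGroupoid G] [IsEtaleGroupoid G]

/-- `a ∈ C*(G)` is singular if the set of all `γ` with `⟨δ_γ, λ_{s(γ)}(a) δ_{s(γ)}⟩ ≠ 0` has empty
interior. -/
def IsSingular (a : FullCStar G) : Prop :=
  interior {γ : G | inner ℂ (delta (⟨γ, rfl⟩ : Fiber (src γ)))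
    (leftRegFull (src γ) a (delta (⟨src γ, src_src γ⟩ : Fiber (src γ)))) ≠ 0} = ∅

end Main

end GroupoidCStar

/-! Every `a` in `C*(G)` defines a bounded function `coeff a` on `G`, and the matrix entries of all
the operators `λ_x(a)` are values of it. The proof applies the uniqueness property to two particular
ideals for one direction, and uses a compression argument for the other.

Uniqueness excludes singular elements. The elements whose function vanishes off a meagre set form a
closed ideal (`singularIdeal`), and it contains every singular element because elements of `𝒞(G)`
are continuous off meagre sets. On the diagonal the function is a uniform limit of functions
continuous on the unit space, so where it is nonzero at a unit it is nonzero on an open set of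
units. By Baire this ideal therefore meets the diagonal only in zero, hence is zero.

Uniqueness forces effectiveness. `C*(G)` acts on `ℓ²(G⁽⁰⁾)`, the entry of `f` from `x` to `y` being
the sum of `f` over all arrows from `x` to `y`. On `C_c(G⁽⁰⁾)` the operator norm dominates the
supremum norm, so the kernel meets the diagonal trivially and the representation is faithful. It
cannot tell isotropy from units: for a bisection `U` inside `Iso(G)`, a function on `U` and its
transport to `s(U)` along the source map act identically, hence coincide, and `U` consists of units
wherever such a function is nonzero.

Conversely, let `I` be a closed ideal meeting the diagonal trivially. Near a unit `x` with trivial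
isotropy a bump function `h` compresses any `f` in `𝒞(G)` to `h * f * h` in `C_c(G⁽⁰⁾)`
(`exists_compression`). If `a ∈ I` had a nonzero coefficient at `x`, some element of `I` would be
close to a function in `C_c(G⁽⁰⁾)` that is large at `x`, which puts a bump function into `I`
(`exists_near_of_lt`). So coefficients of `I` vanish at such units, and after multiplying by
bisection functions at all arrows with such sources. Effectiveness and Baire make these arrows dense
(`exists_trivial_isotropy`); thus every `a ∈ I` is singular, hence zero. -/

namespace GroupoidCStar

/-! ### Topology of the source map: Baire category, trivial isotropy, bump functions -/

section SourceMap

variable {G : Type u} [TopologicalSpace G] [SetGroupoid G] [IsEtaleGroupoid G]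

/-- The source map as a map into the unit space. -/
def srcUnit (γ : G) : (units : Set G) := ⟨src γ, src_mem γ⟩

theorem isLocalHomeomorph_srcUnit : IsLocalHomeomorph (srcUnit : G → (units : Set G)) :=
  IsEtaleGroupoid.isLocalHomeomorph_src

theorem srcUnit_coe (x : (units : Set G)) : srcUnit x.1 = x := Subtype.ext (src_unit _ x.2)

theorem isOpen_image_src {U : Set G} (hU : IsOpen U) : IsOpen (src '' U : Set G) := by
  have h := isOpen_units.isOpenMap_subtype_val _ (isLocalHomeomorph_srcUnit.isOpenMap U hU)
  rwa [image_image] at h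

theorem isOpenEmbedding_srcUnit {U : Set G} (hU : IsOpen U) (hUb : IsBisection U) :
    IsOpenEmbedding (fun γ : U => srcUnit γ.1) := by
  refine .of_continuous_injective_isOpenMap
    (isLocalHomeomorph_srcUnit.continuous.comp continuous_subtype_val) ?_
    (isLocalHomeomorph_srcUnit.isOpenMap.comp hU.isOpenMap_subtype_val)
  intro α β h
  exact Subtype.ext (hUb.1 α.2 β.2 (congrArg Subtype.val h))

/-- Countably many open bisections cover `G`, by second countability, and on each the source map is
an open embedding, which carries meagre sets to meagre sets. -/
theorem isMeagre_image_srcUnit [SecondCountableTopology G] {M : Set G} (hM : IsMeagre M) :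
    IsMeagre (srcUnit '' M) := by
  choose U _ hU hmem hbis using fun γ : G => exists_bisection γ isOpen_univ (mem_univ γ)
  obtain ⟨t, ht, hcov⟩ := TopologicalSpace.countable_cover_nhds
    fun γ => (hU γ).mem_nhds (hmem γ)
  have key : ∀ γ ∈ t, IsMeagre (srcUnit '' (M ∩ U γ)) := by
    intro γ _
    have h1 : IsMeagre ((↑) ⁻¹' M : Set (U γ)) :=
      hM.preimage_of_isOpenMap continuous_subtype_val (hU γ).isOpenMap_subtype_val
    refine ((isOpenEmbedding_srcUnit (hU γ) (hbis γ)).isInducing.isMeagre_image h1).mono ?_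
    rintro _ ⟨δ, ⟨hδ, hδU⟩, rfl⟩
    exact ⟨⟨δ, hδU⟩, hδ, rfl⟩
  refine (isMeagre_biUnion ht key).mono ?_
  rintro _ ⟨δ, hδ, rfl⟩
  obtain ⟨γ, hγ, hδU⟩ := mem_iUnion₂.1 (hcov ▸ mem_univ δ : δ ∈ ⋃ x ∈ t, U x)
  exact mem_iUnion₂.2 ⟨γ, hγ, δ, ⟨hδ, hδU⟩, rfl⟩

/-- Needed for the ideal property: the function of `b * a` at `γ` depends on that of `a` on the
whole fibre `G_{s(γ)}`, so an exceptional set has to be replaced by the union of the fibres that it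
meets. -/
theorem isMeagre_src_saturation [SecondCountableTopology G] {M : Set G} (hM : IsMeagre M) :
    IsMeagre (srcUnit ⁻¹' (srcUnit '' M)) :=
  (isMeagre_image_srcUnit hM).preimage_of_isOpenMap isLocalHomeomorph_srcUnit.continuous
    isLocalHomeomorph_srcUnit.isOpenMap

/-- The complement of the source image of a meagre set meets every nonempty open set of units. -/
theorem exists_mem_notMem_image_srcUnit [SecondCountableTopology G] {M : Set G} (hM : IsMeagre M)
    {V : Set (units : Set G)} (hV : IsOpen V) (hne : V.Nonempty) :
    ∃ x ∈ V, x ∉ srcUnit '' M := by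
  have := IsEtaleGroupoid.t2_units (G := G)
  have := IsEtaleGroupoid.locallyCompact_units (G := G)
  by_contra! h
  exact not_isMeagre_of_isOpen hV hne ((isMeagre_image_srcUnit hM).mono h)

theorem isMeagre_inv {M : Set G} (hM : IsMeagre M) : IsMeagre {γ : G | γ⁻¹ ∈ M} := by
  let e : G ≃ₜ G :=
    { toFun := fun γ => γ⁻¹
      invFun := fun γ => γ⁻¹
      left_inv := inv_inv'
      right_inv := inv_inv'
      continuous_toFun := continuous_inv
      continuous_invFun := continuous_inv }
  exact hM.preimage_of_isOpenMap e.continuous e.isOpenMap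

/-- In an effective groupoid, units with trivial isotropy are dense. -/
theorem exists_trivial_isotropy [SecondCountableTopology G] (hG : IsEffectiveGroupoid G)
    {V : Set G} (hV : IsOpen V) (hne : V.Nonempty) :
    ∃ γ ∈ V, ∀ α : G, src α = src γ → rng α = src γ → α = src γ := by
  have hcl : IsClosed (iso G \ units) := by
    have h := isClosed_eq_units (continuous_src (G := G)) continuous_rng src_mem rng_mem
    exact h.sdiff isOpen_units
  -- The nontrivial isotropy is closed, and by effectiveness an interior point of it would be a
  -- unit; so it is nowhere dense.
  have hnd : IsMeagre (iso G \ units) := by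
    refine (hcl.isNowhereDense_iff.2 ?_).isMeagre
    refine eq_empty_of_forall_notMem fun γ hγ => ?_
    have h1 : γ ∈ (units : Set G) := by
      rw [IsEffectiveGroupoid] at hG
      rw [hG]
      exact interior_mono sdiff_subset hγ
    exact (interior_subset hγ).2 h1
  -- Baire yields a unit in `s(V)` that is not the source of any nontrivial isotropy arrow.
  obtain ⟨x, ⟨γ, hγ, rfl⟩, hx⟩ := exists_mem_notMem_image_srcUnit hnd
    (isLocalHomeomorph_srcUnit.isOpenMap V hV) (hne.image _)
  refine ⟨γ, hγ, fun α hs hr => ?_⟩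
  by_contra h
  refine hx ⟨α, ⟨hs.trans hr.symm, fun hα => h ?_⟩, Subtype.ext hs⟩
  rw [← hs, src_unit α hα]

/-- Urysohn's lemma in `C_c(U)`. -/
theorem exists_bump {U : Set G} (hU : IsOpen U) (hT2 : T2Space U) {γ : G} (hγ : γ ∈ U) :
    ∃ f ∈ CcOn U, f γ = 1 ∧ ∀ δ, ‖f δ‖ ≤ 1 := by
  have := locallyCompact_open hU
  classical
  obtain ⟨φ, h1, -, ⟨hc, h01⟩⟩ := exists_continuous_one_zero_of_isCompact (X := U)
    (isCompact_singleton (x := ⟨γ, hγ⟩)) isClosed_empty (disjoint_empty _)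
  refine ⟨fun δ => if h : δ ∈ U then (φ ⟨δ, h⟩ : ℂ) else 0, ⟨?_, (↑) '' (tsupport φ), ?_, ?_, ?_⟩,
    ?_, ?_⟩
  · rw [continuousOn_iff_continuous_domRestrict]
    have : U.domRestrict (fun δ => if h : δ ∈ U then (φ ⟨δ, h⟩ : ℂ) else 0)
        = fun δ : U => (φ δ : ℂ) := by
      funext δ
      simp
    rw [this]
    exact Complex.continuous_ofReal.comp φ.continuous
  · rintro _ ⟨δ, -, rfl⟩
    exact δ.2
  · exact hc.isCompact.image continuous_subtype_val
  · intro δ hδ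
    by_cases h : δ ∈ U
    · have : φ ⟨δ, h⟩ = 0 := by
        by_contra h2
        exact hδ ⟨⟨δ, h⟩, subset_tsupport _ h2, rfl⟩
      simp [h, this]
    · simp [h]
  · simpa [hγ] using h1 rfl
  · intro δ
    by_cases h : δ ∈ U
    · have := h01 ⟨δ, h⟩
      simp only [h, dif_pos, Complex.norm_real, Real.norm_eq_abs]
      rw [abs_of_nonneg this.1]
      exact this.2
    · simp [h]

/-- The compact support is closed in the Hausdorff set `U`, so the extension by zero stays
continuous on `U`. In a non-Hausdorff `G` it need not be continuous on all of `G`, which is why the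
ambient set is part of the statement. -/
theorem mem_CcOn_of_subset {U V : Set G} (hV : V ⊆ U) {f : G → ℂ} (hf : f ∈ CcOn V)
    (hU : IsOpen V) (hT2 : T2Space U) : f ∈ CcOn U := by
  obtain ⟨hc, K, hK, hKc, h0⟩ := hf
  refine ⟨?_, K, hK.trans hV, hKc, h0⟩
  have hcl : IsClosed ((↑) ⁻¹' K : Set U) :=
    (Topology.IsInducing.subtypeVal.isCompact_preimage_iff (by
      rw [Subtype.range_coe]; exact hK.trans hV) |>.2 hKc).isClosed
  obtain ⟨O, hO, hOK⟩ := isOpen_induced_iff.1 hcl.isOpen_compl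
  intro γ hγ
  by_cases h : γ ∈ V
  · exact (hc.continuousAt (hU.mem_nhds h)).continuousWithinAt
  · have hmem : ∀ δ : G, ∀ hδ : δ ∈ U, δ ∈ O ↔ δ ∉ K := fun δ hδ => by
      have := Set.ext_iff.1 hOK ⟨δ, hδ⟩
      simpa using this
    have hγO : γ ∈ O := (hmem γ hγ).2 fun h2 => h (hK h2)
    refine (continuousWithinAt_const (b := (0 : ℂ))).congr_of_eventuallyEq ?_
      (h0 γ fun h2 => h (hK h2))
    filter_upwards [self_mem_nhdsWithin, mem_nhdsWithin_of_mem_nhds (hO.mem_nhds hγO)] with δ h1 h2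
    exact h0 δ ((hmem δ h1).1 h2)

/-- An element of `𝒞(G)` is continuous at all points off a meagre set. -/
theorem exists_isMeagre_continuousAt {f : G → ℂ} (hf : f ∈ ccSpan G) :
    ∃ M : Set G, IsMeagre M ∧ ∀ γ ∉ M, ContinuousAt f γ := by
  induction hf using Submodule.span_induction with
  | mem f h =>
    obtain ⟨U, hU, -, hc, K, hKU, -, h0⟩ := h
    -- Inside `U` the function is continuous and off the closure of `U` it vanishes locally. Only
    -- the boundary is left, which is nowhere dense since `U` is open.
    refine ⟨frontier U, ?_, fun γ hγ => ?_⟩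
    · refine (isClosed_frontier.isNowhereDense_iff.2 ?_).isMeagre
      rw [← frontier_compl]
      exact interior_frontier hU.isClosed_compl
    · by_cases h : γ ∈ U
      · exact hc.continuousAt (hU.mem_nhds h)
      · have h2 : γ ∈ (closure U)ᶜ := fun h3 => hγ (by
          rw [hU.frontier_eq]
          exact ⟨h3, h⟩)
        refine (continuousAt_const (y := (0 : ℂ))).congr ?_
        filter_upwards [isClosed_closure.isOpen_compl.mem_nhds h2] with δ hδ
        exact (h0 δ fun h3 => hδ (subset_closure (hKU h3))).symm
  | zero => exact ⟨∅, IsMeagre.empty, fun γ _ => continuousAt_const⟩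
  | add f g _ _ h1 h2 =>
    obtain ⟨M, hM, h1⟩ := h1
    obtain ⟨N, hN, h2⟩ := h2
    exact ⟨M ∪ N, hM.union hN, fun γ hγ =>
      (h1 γ fun h => hγ (Or.inl h)).add (h2 γ fun h => hγ (Or.inr h))⟩
  | smul c f _ h =>
    obtain ⟨M, hM, h⟩ := h
    exact ⟨M, hM, fun γ hγ => (h γ hγ).const_smul c⟩

end SourceMap

end GroupoidCStar

namespace GroupoidCStar

/-! ### The function on `G` attached to an element of `C*(G)` -/

section Coefficients

variable {G : Type u} [TopologicalSpace G] [SetGroupoid G] [IsEtaleGroupoid G]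

/-- The function on `G` defined by an element of `C*(G)`:
`γ ↦ ⟨δ_γ, λ_{s(γ)}(a) δ_{s(γ)}⟩`. -/
noncomputable def coeff (a : FullCStar G) (γ : G) : ℂ :=
  leftRegFull (src γ) a (delta (⟨src γ, src_src γ⟩ : Fiber (src γ))) (⟨γ, rfl⟩ : Fiber (src γ))

theorem isSingular_iff (a : FullCStar G) :
    IsSingular a ↔ interior {γ : G | coeff a γ ≠ 0} = ∅ := by
  simp only [IsSingular, inner_delta, coeff]

theorem leftRegFull_toFull (x : G) (f : CcAlg G) : leftRegFull x (toFull f) = leftRegOp x f :=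
  extend_rep_coe (leftReg x) f

theorem norm_delta {x : G} (γ : Fiber x) : ‖(delta γ : L2Fiber x)‖ = 1 := by
  classical
  simp [delta, lp.norm_single]

theorem norm_leftRegFull_apply_le (x : G) (a : FullCStar G) (β γ : Fiber x) :
    ‖leftRegFull x a (delta β) γ‖ ≤ ‖a‖ := by
  calc ‖leftRegFull x a (delta β) γ‖ ≤ ‖leftRegFull x a (delta β)‖ :=
        lp.norm_apply_le_norm (by norm_num) _ _
    _ ≤ ‖leftRegFull x a‖ * ‖(delta β : L2Fiber x)‖ := ContinuousLinearMap.le_opNorm _ _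
    _ ≤ ‖a‖ := by
      rw [norm_delta, mul_one]
      exact NonUnitalStarAlgHom.norm_apply_le _ a

theorem continuous_leftRegFull_apply (x : G) (β γ : Fiber x) :
    Continuous fun a : FullCStar G => leftRegFull x a (delta β) γ := by
  let φ : FullCStar G →+ ℂ :=
    { toFun := fun a => leftRegFull x a (delta β) γ
      map_zero' := by rw [map_zero]; rfl
      map_add' := fun a b => by rw [map_add]; rfl }
  exact AddMonoidHomClass.continuous_of_bound φ 1 fun a => by
    rw [one_mul]
    exact norm_leftRegFull_apply_le x a β γ

/-- For `f` in `𝒞(G)` both sides equal `f(γβ⁻¹)`, although they are computed in the fibres over `x`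
and over `r(β)`; both are continuous in `a`. Hence a single function on `G` records the matrices of
all `λ_x(a)`. -/
theorem leftRegFull_delta (x : G) (a : FullCStar G) (β γ : Fiber x) :
    leftRegFull x a (delta β) γ = coeff a (γ.1 * β.1⁻¹) := by
  induction a using full_induction with
  | hp =>
    exact isClosed_eq (continuous_leftRegFull_apply x β γ) (continuous_leftRegFull_apply _ _ _)
  | ih f =>
    rw [coeff, leftRegFull_toFull, leftRegFull_toFull, leftRegOp_delta, leftRegOp_delta,
      inv_of_unit (src_mem _), mul_src_self]

theorem coeff_toFull (f : CcAlg G) (γ : G) : coeff (toFull f) γ = f.toFn γ := by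
  rw [coeff, leftRegFull_toFull, leftRegOp_delta, inv_of_unit (src_mem _), mul_src_self]

/-- The coefficients recover `f`, so the universal seminorm is a norm. -/
theorem toFull_injective : Function.Injective (toFull : CcAlg G → FullCStar G) := by
  intro f g h
  exact CcAlg.ext (funext fun γ => by rw [← coeff_toFull, h, coeff_toFull])

theorem norm_coeff_le (a : FullCStar G) (γ : G) : ‖coeff a γ‖ ≤ ‖a‖ :=
  norm_leftRegFull_apply_le _ a _ _

theorem continuous_coeff (γ : G) : Continuous fun a : FullCStar G => coeff a γ :=
  continuous_leftRegFull_apply _ _ _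

theorem coeff_zero (γ : G) : coeff (0 : FullCStar G) γ = 0 := by
  rw [coeff, map_zero]; rfl

theorem coeff_add (a b : FullCStar G) (γ : G) : coeff (a + b) γ = coeff a γ + coeff b γ := by
  rw [coeff, map_add]; rfl

theorem coeff_neg (a : FullCStar G) (γ : G) : coeff (-a) γ = -coeff a γ := by
  rw [coeff, map_neg]; rfl

theorem coeff_sub (a b : FullCStar G) (γ : G) : coeff (a - b) γ = coeff a γ - coeff b γ := by
  rw [coeff, map_sub]; rfl

theorem coeff_star (a : FullCStar G) (γ : G) : coeff (star a) γ = conj (coeff a γ⁻¹) := by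
  induction a using full_induction with
  | hp =>
    exact isClosed_eq ((continuous_coeff γ).comp continuous_star)
      (Complex.continuous_conj.comp (continuous_coeff γ⁻¹))
  | ih f => rw [← toFull_star, coeff_toFull, coeff_toFull, CcAlg.toFn_star, invol]

theorem norm_sub_coeff_le (f : CcAlg G) (a : FullCStar G) (γ : G) :
    ‖f.toFn γ - coeff a γ‖ ≤ ‖toFull f - a‖ := by
  rw [← coeff_toFull, ← coeff_sub]
  exact norm_coeff_le _ _

/-- If the function of `a` vanishes on `G_x`, then so does that of `b * a`. -/
theorem coeff_mul_eq_zero {a : FullCStar G} (b : FullCStar G) {γ : G}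
    (h : ∀ β, src β = src γ → coeff a β = 0) : coeff (b * a) γ = 0 := by
  have h1 : leftRegFull (src γ) a (delta (⟨src γ, src_src γ⟩ : Fiber (src γ))) = 0 := by
    refine lp.ext (funext fun β => ?_)
    rw [leftRegFull_delta, h]
    · rfl
    · rw [src_mul_inv (β.2.trans (src_src γ).symm), rng_src]
  rw [coeff, map_mul, mul_apply_eq_comp, h1, map_zero]
  rfl

/-- A function of `C_c(U)` with value `1` at `γ` moves the coefficient at `γ` to the unit. -/
theorem coeff_star_mul {U : Set G} (hU : IsBisection U) (f : CcAlg G) (hf : f.toFn ∈ CcOn U)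
    {γ : G} (hγ : γ ∈ U) (h1 : f.toFn γ = 1) (a : FullCStar G) :
    coeff (star (toFull f) * a) (src γ) = coeff a γ := by
  obtain ⟨-, K, hKU, -, h0⟩ := hf
  let e : Fiber (src γ) := ⟨src γ, src_src γ⟩
  let g : Fiber (src γ) := ⟨γ, rfl⟩
  -- The source map is injective on `U`, so the column of `λ(f)` at the unit `s(γ)` has the single
  -- entry `f(γ) = 1`. The coefficient of `f^* a` then follows by passing to the adjoint.
  have hd : leftRegFull (src γ) (toFull f) (delta e) = delta g := by
    classical
    refine lp.ext (funext fun β => ?_)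
    rw [leftRegFull_toFull, leftRegOp_delta]
    change f.toFn (β.1 * (src γ)⁻¹) = _
    have : β.1 * (src γ)⁻¹ = β.1 := by
      rw [inv_of_unit (src_mem _)]
      exact (congrArg (β.1 * ·) β.2).symm.trans (mul_src_self _)
    rw [this]
    by_cases hβ : β = g
    · subst hβ
      simp [delta, g, h1]
    · have h2 : f.toFn β.1 = 0 := h0 _ fun h3 => hβ (Subtype.ext (hU.1 (hKU h3) hγ β.2))
      simp [delta, h2, hβ]
  have e1 : coeff (star (toFull f) * a) (src γ)
      = leftRegFull (src γ) (star (toFull f) * a) (delta e) e := by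
    rw [leftRegFull_delta]
    change _ = coeff _ (src γ * (src γ)⁻¹)
    rw [mul_inv_self, rng_src]
  rw [e1, map_mul, mul_apply_eq_comp, ← inner_delta e, map_star,
    ContinuousLinearMap.star_eq_adjoint, ContinuousLinearMap.adjoint_inner_right, hd, inner_delta]
  rfl

end Coefficients

end GroupoidCStar

namespace GroupoidCStar

/-! ### The diagonal: norm estimates on `C_c(G⁽⁰⁾)` -/

section Diagonal

variable {G : Type u} [TopologicalSpace G] [SetGroupoid G] [IsEtaleGroupoid G]

/-- A function in `C_c(G⁽⁰⁾)` as an element of `𝒞(G)`. -/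
def ofUnits (h : G → ℂ) (hh : h ∈ CcOn (units : Set G)) : CcAlg G := ⟨h, ccOn_units_subset hh⟩

theorem toFn_ofUnits (h : G → ℂ) (hh : h ∈ CcOn (units : Set G)) : (ofUnits h hh).toFn = h := rfl

theorem isBisection_units : IsBisection (units : Set G) :=
  ⟨fun x hx y hy h => by rwa [src_unit x hx, src_unit y hy] at h,
    fun x hx y hy h => by rwa [rng_unit x hx, rng_unit y hy] at h⟩

theorem eq_zero_of_mem_CcOn {U : Set G} {h : G → ℂ} (hh : h ∈ CcOn U) {γ : G} (hγ : γ ∉ U) :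
    h γ = 0 := by
  obtain ⟨-, K, hKU, -, h0⟩ := hh
  exact h0 γ fun h2 => hγ (hKU h2)

theorem ofReal_mem_CcOn {U : Set G} {h : G → ℂ} (hh : h ∈ CcOn U) {F : ℂ → ℝ}
    (hF : Continuous F) (hF0 : F 0 = 0) : (fun γ => (F (h γ) : ℂ)) ∈ CcOn U := by
  obtain ⟨hc, K, hKU, hK, h0⟩ := hh
  refine ⟨(Complex.continuous_ofReal.comp hF).comp_continuousOn hc, K, hKU, hK, fun γ hγ => ?_⟩
  simp [h0 γ hγ, hF0]

/-- `norm_le_of_units` treats real-valued functions; applying it to the real and imaginary parts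
costs the factor 2. -/
theorem norm_toFull_ofUnits_le {h : G → ℂ} (hh : h ∈ CcOn (units : Set G)) {C : ℝ}
    (hC : ∀ γ, ‖h γ‖ ≤ C) (hC0 : 0 ≤ C) : ‖toFull (ofUnits h hh)‖ ≤ 2 * C := by
  rw [norm_toFull]
  refine universalNorm_le fun H _ _ _ ρ => ?_
  have hre := ofReal_mem_CcOn hh Complex.continuous_re Complex.zero_re
  have him := ofReal_mem_CcOn hh Complex.continuous_im Complex.zero_im
  have e : ofUnits h hh = ofUnits _ hre + Complex.I • ofUnits _ him := by
    refine CcAlg.ext (funext fun γ => ?_)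
    change h γ = ((h γ).re : ℂ) + Complex.I * ((h γ).im : ℂ)
    rw [mul_comm, Complex.re_add_im]
  have h1 : ‖ρ (ofUnits _ hre)‖ ≤ C :=
    norm_le_of_units isOpen_units isBisection_units subset_rfl _ hre
      (fun γ => Complex.conj_ofReal _) hC0 (fun γ => by
        rw [toFn_ofUnits, Complex.norm_real]
        exact (Complex.abs_re_le_norm _).trans (hC γ)) ρ
  have h2 : ‖ρ (ofUnits _ him)‖ ≤ C :=
    norm_le_of_units isOpen_units isBisection_units subset_rfl _ him
      (fun γ => Complex.conj_ofReal _) hC0 (fun γ => by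
        rw [toFn_ofUnits, Complex.norm_real]
        exact (Complex.abs_im_le_norm _).trans (hC γ)) ρ
  rw [e, map_add, map_smul]
  refine (norm_add_le _ _).trans ?_
  rw [norm_smul, Complex.norm_I]
  linarith

theorem exists_ofUnits_near {a : FullCStar G} (ha : a ∈ diagonal G) {ε : ℝ} (hε : 0 < ε) :
    ∃ (h : G → ℂ) (hh : h ∈ CcOn (units : Set G)), ‖toFull (ofUnits h hh) - a‖ < ε := by
  obtain ⟨_, ⟨f, hf, rfl⟩, h⟩ := Metric.mem_closure_iff.1 ha ε hε
  refine ⟨f.toFn, hf, ?_⟩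
  rwa [dist_comm, dist_eq_norm] at h

/-- An element of the diagonal vanishes if the distance to it bounds the supremum norm on
`C_c(G⁽⁰⁾)`. -/
theorem eq_zero_of_mem_diagonal {a : FullCStar G} (ha : a ∈ diagonal G)
    (h : ∀ (f : G → ℂ) (hf : f ∈ CcOn (units : Set G)) (x : G), x ∈ (units : Set G) →
      ‖f x‖ ≤ ‖toFull (ofUnits f hf) - a‖) : a = 0 := by
  by_contra hne
  have hpos : 0 < ‖a‖ := norm_pos_iff.2 hne
  -- With distance below `‖a‖ / 4` the supremum of `f` is at most `‖a‖ / 4` and its norm at most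
  -- `‖a‖ / 2`, so `‖a‖` would be less than `3‖a‖ / 4`.
  obtain ⟨f, hf, hfa⟩ := exists_ofUnits_near ha (ε := ‖a‖ / 4) (by positivity)
  have h1 : ‖toFull (ofUnits f hf)‖ ≤ 2 * (‖a‖ / 4) := by
    refine norm_toFull_ofUnits_le hf (fun γ => ?_) (by positivity)
    by_cases hγ : γ ∈ (units : Set G)
    · exact (h f hf γ hγ).trans hfa.le
    · rw [eq_zero_of_mem_CcOn hf hγ, norm_zero]
      positivity
  have h2 : ‖a‖ ≤ ‖toFull (ofUnits f hf)‖ + ‖toFull (ofUnits f hf) - a‖ := by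
    have := norm_sub_le (toFull (ofUnits f hf)) (toFull (ofUnits f hf) - a)
    rwa [sub_sub_cancel] at this
  linarith

theorem zero_mem_diagonal : (0 : FullCStar G) ∈ diagonal G := by
  refine subset_closure ⟨0, ⟨continuousOn_const, ∅, empty_subset _, isCompact_empty, ?_⟩,
    map_zero _⟩
  intro γ _
  rfl

theorem inter_diagonal_eq_singleton {I : TwoSidedIdeal (FullCStar G)}
    (h : ∀ a ∈ I, a ∈ diagonal G → a = 0) :
    (I : Set (FullCStar G)) ∩ diagonal G = {0} := by
  refine Subset.antisymm (fun a ha => h a ha.1 ha.2) ?_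
  rintro _ rfl
  exact ⟨I.zero_mem, zero_mem_diagonal⟩

end Diagonal

/-! ### Singular elements lie in a closed ideal that meets the diagonal trivially -/

section SingularIdeal

variable {G : Type u} [TopologicalSpace G] [SetGroupoid G] [IsEtaleGroupoid G]

theorem exists_toFull_near (a : FullCStar G) {ε : ℝ} (hε : 0 < ε) :
    ∃ f : CcAlg G, ‖toFull f - a‖ < ε := by
  obtain ⟨f, hf⟩ := isDenseInducing_toFull.dense.exists_dist_lt a hε
  exact ⟨f, by rwa [dist_comm, dist_eq_norm] at hf⟩

/-- If the function of `a` is nonzero at `γ` and `f` is close to `a` and continuous at `γ`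
within `S`, then the function of `a` is nonzero near `γ` within `S`. -/
theorem eventually_coeff_ne_zero {a : FullCStar G} {f : CcAlg G} {γ : G} {S : Set G}
    (hf : ContinuousWithinAt f.toFn S γ) (h : 2 * ‖toFull f - a‖ < ‖coeff a γ‖) :
    ∀ᶠ δ in 𝓝[S] γ, coeff a δ ≠ 0 := by
  -- Half of the coefficient's size remains for `f` at `γ`; continuity keeps `f` larger than its
  -- distance to `a` nearby, so the function of `a` cannot vanish there.
  have h1 : ‖toFull f - a‖ < ‖f.toFn γ‖ := by
    have h2 := norm_sub_coeff_le f a γ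
    have h3 := norm_sub_norm_le (coeff a γ) (f.toFn γ)
    rw [norm_sub_rev] at h3
    linarith
  filter_upwards [hf.norm.eventually (lt_mem_nhds h1)] with δ hδ h0
  have := norm_sub_coeff_le f a δ
  rw [h0, sub_zero] at this
  exact absurd hδ (not_lt.2 this)

/-- Take `f n → a` in `𝒞(G)`. Off one meagre set all `f n` are continuous, and at such a point a
nonzero coefficient would persist on a neighbourhood. Meagre sets, unlike sets with empty interior,
are stable under countable unions, which is what makes an ideal of them. -/
theorem IsSingular.isMeagre {a : FullCStar G} (ha : IsSingular a) :
    IsMeagre {γ : G | coeff a γ ≠ 0} := by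
  rw [isSingular_iff] at ha
  choose f hf using fun n : ℕ => exists_toFull_near a (ε := 1 / ((n : ℝ) + 1)) (by positivity)
  choose M hM hMc using fun n => exists_isMeagre_continuousAt (f n).2
  refine (isMeagre_iUnion hM).mono fun γ hγ => ?_
  by_contra h
  have hγ' : coeff a γ ≠ 0 := hγ
  obtain ⟨n, hn⟩ := exists_nat_one_div_lt (half_pos (norm_pos_iff.2 hγ'))
  have hc : ContinuousAt (f n).toFn γ := hMc n γ fun h2 => h (mem_iUnion.2 ⟨n, h2⟩)
  have h3 := eventually_coeff_ne_zero (S := univ) hc.continuousWithinAt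
    (a := a) (by linarith [hf n])
  rw [nhdsWithin_univ] at h3
  have h4 : γ ∈ interior {γ : G | coeff a γ ≠ 0} := mem_interior_iff_mem_nhds.2 h3
  rw [ha] at h4
  exact h4

variable [SecondCountableTopology G]

theorem isMeagre_coeff_mul_left {a : FullCStar G} (ha : IsMeagre {γ : G | coeff a γ ≠ 0})
    (b : FullCStar G) : IsMeagre {γ : G | coeff (b * a) γ ≠ 0} := by
  refine (isMeagre_src_saturation ha).mono fun γ hγ => ?_
  by_contra h
  refine hγ (coeff_mul_eq_zero b fun β hβ => ?_)
  by_contra h2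
  exact h ⟨β, h2, Subtype.ext hβ⟩

theorem isMeagre_coeff_star {a : FullCStar G} (ha : IsMeagre {γ : G | coeff a γ ≠ 0}) :
    IsMeagre {γ : G | coeff (star a) γ ≠ 0} := by
  refine (isMeagre_inv ha).mono fun γ hγ => ?_
  by_contra h
  refine hγ ?_
  rw [mem_ofPred_eq, mem_ofPred_eq, not_not] at h
  rw [coeff_star, h, map_zero]

/-- The elements whose function vanishes off a meagre set form an ideal. -/
noncomputable def singularIdeal (G : Type u) [TopologicalSpace G] [SetGroupoid G]
    [IsEtaleGroupoid G] [SecondCountableTopology G] : TwoSidedIdeal (FullCStar G) :=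
  .mk' {a | IsMeagre {γ : G | coeff a γ ≠ 0}}
    (by simpa [coeff_zero] using IsMeagre.empty)
    (fun {a b} ha hb => (ha.union hb).mono fun γ hγ => by
      by_contra h
      simp only [mem_union, mem_ofPred_eq, not_or, not_not] at h
      exact hγ (by rw [coeff_add, h.1, h.2, add_zero]))
    (fun {a} ha => by simpa [coeff_neg] using ha)
    (fun {b a} ha => isMeagre_coeff_mul_left ha b)
    -- Vanishing on a fibre passes to left multiples only; the right multiple `a * b` is handled as
    -- the adjoint of `star b * star a`.
    (fun {a b} ha => by
      have := isMeagre_coeff_star (isMeagre_coeff_mul_left (isMeagre_coeff_star ha) (star b))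
      simpa using this)

theorem mem_singularIdeal {a : FullCStar G} :
    a ∈ singularIdeal G ↔ IsMeagre {γ : G | coeff a γ ≠ 0} := by
  rw [singularIdeal, TwoSidedIdeal.mem_mk']
  rfl

/-- Coefficients are continuous in the element, so the function of a limit vanishes wherever those
of a convergent sequence all do: the exceptional set lies in a countable union of meagre sets. -/
theorem isClosed_singularIdeal : IsClosed (singularIdeal G : Set (FullCStar G)) := by
  refine isClosed_of_closure_subset fun a ha => ?_
  obtain ⟨b, hb, hba⟩ := mem_closure_iff_seq_limit.1 ha
  refine mem_singularIdeal.2 ((isMeagre_iUnion fun n => mem_singularIdeal.1 (hb n)).mono ?_)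
  intro γ hγ
  by_contra h
  simp only [mem_iUnion, mem_ofPred_eq, not_exists, not_not] at h
  have h1 := ((continuous_coeff γ).tendsto a).comp hba
  refine hγ (tendsto_nhds_unique h1 ?_)
  simp only [Function.comp_def, h]
  exact tendsto_const_nhds

/-- Approximants from `C_c(G⁽⁰⁾)` are continuous on the units, so a nonzero value at `x` spreads to
an open set of units, which is not contained in the source image of a meagre set. -/
theorem coeff_eq_zero_of_mem_diagonal {a : FullCStar G} (ha : a ∈ singularIdeal G)
    (hd : a ∈ diagonal G) {x : G} (hx : x ∈ (units : Set G)) : coeff a x = 0 := by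
  by_contra hne
  obtain ⟨f, hf, hfa⟩ := exists_ofUnits_near hd (ε := ‖coeff a x‖ / 2)
    (half_pos (norm_pos_iff.2 hne))
  have h1 := eventually_coeff_ne_zero (f := ofUnits f hf) (hf.1 x hx) (a := a) (by linarith)
  rw [isOpen_units.nhdsWithin_eq hx] at h1
  obtain ⟨V, hV, hVo, hxV⟩ := eventually_nhds_iff.1 h1
  obtain ⟨y, hyV, hy⟩ := exists_mem_notMem_image_srcUnit (mem_singularIdeal.1 ha)
    (hVo.preimage (continuous_subtype_val (p := (· ∈ (units : Set G))))) ⟨⟨x, hx⟩, hxV⟩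
  exact hy ⟨y.1, hV _ hyV, srcUnit_coe y⟩

theorem FullUniqueness.eq_zero_of_isSingular (hG : FullUniqueness G) {a : FullCStar G}
    (ha : IsSingular a) : a = 0 := by
  have hbot : singularIdeal G = ⊥ := by
    by_contra hne
    refine hG _ isClosed_singularIdeal hne (inter_diagonal_eq_singleton fun b hb hd => ?_)
    refine eq_zero_of_mem_diagonal hd fun f hf x hx => ?_
    have := norm_sub_coeff_le (ofUnits f hf) b x
    rwa [coeff_eq_zero_of_mem_diagonal hb hd hx, sub_zero] at this
  have h1 : a ∈ singularIdeal G := mem_singularIdeal.2 ha.isMeagre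
  rw [hbot] at h1
  exact (TwoSidedIdeal.mem_bot _).1 h1

end SingularIdeal

end GroupoidCStar

namespace GroupoidCStar

/-! ### The algebraic action on functions on the unit space -/

section OrbitAction

variable {G : Type u} [SetGroupoid G]

/-- The range map as a map into the unit space. -/
def rngUnit (γ : G) : (units : Set G) := ⟨rng γ, rng_mem γ⟩

/-- The action of a function `f` on `G` on a function `ξ` on the unit space:
`(f ξ)(y) = ∑_{β ∈ G_y} f(β⁻¹) ξ(r(β))`. -/
noncomputable def orbitAct (f : G → ℂ) (ξ : ↥(units : Set G) → ℂ) (y : (units : Set G)) : ℂ :=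
  leftAct y.1 f (fun β => ξ (rngUnit β.1)) ⟨y.1, src_unit _ y.2⟩

theorem unit_mul_fiber_inv {y : G} (β : Fiber y) : y * β.1⁻¹ = β.1⁻¹ := by
  obtain ⟨β, rfl⟩ := β
  change src β * β⁻¹ = β⁻¹
  rw [← rng_inv, rng_mul_self]

theorem orbitAct_eq_finsum (f : G → ℂ) (ξ : ↥(units : Set G) → ℂ) (y : (units : Set G)) :
    orbitAct f ξ y = ∑ᶠ β : Fiber y.1, f β.1⁻¹ * ξ (rngUnit β.1) := by
  rw [orbitAct, leftAct]
  exact finsum_congr fun β => by rw [unit_mul_fiber_inv]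

/-- Right translation by `γ` identifies `G_x` with `G_{r(γ)}` and preserves ranges. So functions on
a fibre that factor through the range map are preserved by `leftAct`, and `orbitAct` inherits
multiplicativity from it. -/
theorem leftAct_comp_rngUnit (f : G → ℂ) (ξ : ↥(units : Set G) → ℂ) {x : G} (γ : Fiber x) :
    leftAct x f (fun β => ξ (rngUnit β.1)) γ = orbitAct f ξ (rngUnit γ.1) := by
  rw [orbitAct_eq_finsum, leftAct]
  refine Eq.trans ?_
    (finsum_fiber γ.1 γ.2 rfl (fun α => f α⁻¹ * ξ (rngUnit α))).symm
  refine finsum_congr fun δ => ?_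
  have h := δ.2.trans γ.2.symm
  have h2 : rngUnit (δ.1 * γ.1⁻¹) = rngUnit δ.1 := Subtype.ext (rng_mul_inv h)
  rw [mul_inv_inv h, h2]

theorem orbitAct_add_left {f g : G → ℂ} (hf : FiniteOnFibers f) (hg : FiniteOnFibers g)
    (ξ : ↥(units : Set G) → ℂ) : orbitAct (f + g) ξ = orbitAct f ξ + orbitAct g ξ := by
  funext y
  rw [orbitAct, leftAct_add_left hf hg]
  rfl

theorem orbitAct_smul_left (c : ℂ) (f : G → ℂ) (ξ : ↥(units : Set G) → ℂ) :
    orbitAct (c • f) ξ = c • orbitAct f ξ := by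
  funext y
  rw [orbitAct, leftAct_smul_left]
  rfl

theorem orbitAct_add_right {f : G → ℂ} (hf : FiniteOnFibers f) (ξ η : ↥(units : Set G) → ℂ) :
    orbitAct f (ξ + η) = orbitAct f ξ + orbitAct f η := by
  funext y
  exact congrFun (leftAct_add_right hf y.1 (fun β => ξ (rngUnit β.1))
    (fun β => η (rngUnit β.1))) _

theorem orbitAct_smul_right (c : ℂ) (f : G → ℂ) (ξ : ↥(units : Set G) → ℂ) :
    orbitAct f (c • ξ) = c • orbitAct f ξ := by
  funext y
  exact congrFun (leftAct_smul_right c f y.1 (fun β => ξ (rngUnit β.1))) _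

theorem orbitAct_conv {f g : G → ℂ} (hf : FiniteOnFibers f) (hg : FiniteOnFibers g)
    (ξ : ↥(units : Set G) → ℂ) : orbitAct (conv f g) ξ = orbitAct f (orbitAct g ξ) := by
  funext y
  rw [orbitAct, leftAct_conv hf hg, orbitAct]
  congr 1
  exact funext fun β => leftAct_comp_rngUnit g ξ β

/-- The matrix entry at `(y, x)` is the sum of `f` over the arrows with source `x` and range `y`,
and inversion exchanges these with the arrows from `y` to `x`. -/
theorem orbitAct_single_invol [DecidableEq (units : Set G)] (f : G → ℂ)
    (x y : (units : Set G)) :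
    orbitAct (invol f) (Pi.single x 1) y = conj (orbitAct f (Pi.single y 1) x) := by
  -- Sums over two different fibres are written as conditional sums over `G`, where inversion can
  -- serve as the change of variable.
  have key : ∀ (f : G → ℂ) (x y : (units : Set G)), orbitAct f (Pi.single x 1) y
      = ∑ᶠ β : G, ∑ᶠ _ : src β = y.1, f β⁻¹ * (Pi.single x (1 : ℂ) : _ → ℂ) (rngUnit β) := by
    intro f x y
    rw [orbitAct_eq_finsum]
    exact finsum_subtype_eq_finsum_cond (M := ℂ)
      (f := fun β => f β⁻¹ * (Pi.single x (1 : ℂ) : _ → ℂ) (rngUnit β)) (fun β => src β = y.1)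
  classical
  let e : G ≃ G := ⟨fun γ => γ⁻¹, fun γ => γ⁻¹, inv_inv', inv_inv'⟩
  rw [key, key]
  refine Eq.trans ?_ ((starRingAut (R := ℂ)).toAddEquiv.map_finsum _).symm
  rw [← finsum_comp_equiv e]
  refine finsum_congr fun β => ?_
  simp only [finsum_eq_if]
  have h1 : rngUnit β⁻¹ = x ↔ src β = x.1 := by rw [Subtype.ext_iff, ← rng_inv]; rfl
  have h2 : rngUnit β = y ↔ src β⁻¹ = y.1 := by rw [Subtype.ext_iff, src_inv]; rfl
  change (if src β⁻¹ = y.1 then invol f β⁻¹⁻¹ * (Pi.single x (1 : ℂ) : _ → ℂ) (rngUnit β⁻¹) else 0)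
    = _
  simp only [Pi.single_apply, h1, h2, invol, inv_inv']
  split_ifs <;> simp

end OrbitAction

/-! ### The orbit representation on `ℓ²(G⁽⁰⁾)` and effectiveness -/

section OrbitRepresentation

variable {G : Type u} [TopologicalSpace G] [SetGroupoid G]

/-- Exactly one arrow of `U` ends at `r(α)`: a bisection acts as a weighted partial bijection of the
unit space. -/
theorem orbitAct_of_mem {U : Set G} (hU : IsBisection U) {f : G → ℂ} (hf : f ∈ CcOn U) {α : G}
    (hα : α ∈ U) (ξ : ↥(units : Set G) → ℂ) :
    orbitAct f ξ (rngUnit α) = f α * ξ ⟨src α, src_mem α⟩ := by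
  obtain ⟨-, K, hKU, -, h0⟩ := hf
  rw [orbitAct_eq_finsum, finsum_eq_single _ (⟨α⁻¹, src_inv α⟩ : Fiber (rngUnit α).1)]
  · have h : rngUnit α⁻¹ = ⟨src α, src_mem α⟩ := Subtype.ext (rng_inv α)
    rw [inv_inv', h]
  · intro β hβ
    by_contra h
    have h1 : β.1⁻¹ ∈ K := by_contra fun h2 => left_ne_zero_of_mul h (h0 _ h2)
    refine hβ (Subtype.ext ?_)
    change β.1 = α⁻¹
    rw [← inv_inv' β.1, hU.2 (hKU h1) hα ((rng_inv _).trans β.2)]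

theorem orbitAct_of_forall {U : Set G} {f : G → ℂ} (hf : f ∈ CcOn U) {y : (units : Set G)}
    (hy : ∀ α ∈ U, rng α ≠ y.1) (ξ : ↥(units : Set G) → ℂ) : orbitAct f ξ y = 0 := by
  obtain ⟨-, K, hKU, -, h0⟩ := hf
  rw [orbitAct_eq_finsum]
  refine finsum_eq_zero_of_forall_eq_zero fun β => ?_
  rw [h0 _ fun h => hy _ (hKU h) ((rng_inv _).trans β.2), zero_mul]

variable (G) in
/-- The Hilbert space `ℓ²(G⁽⁰⁾)`. -/
abbrev L2Units : Type u := lp (fun _ : (units : Set G) => ℂ) 2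

theorem orbitAct_bound_bisection {f : G → ℂ} (hf : f ∈ bisectionFns G) :
    ∃ C : ℝ, 0 ≤ C ∧ ∀ ξ : L2Units G, ∃ η : L2Units G,
      (∀ y, η y = orbitAct f ξ y) ∧ ‖η‖ ≤ C * ‖ξ‖ := by
  obtain ⟨U, -, hUb, hfU⟩ := hf
  obtain ⟨M, hM0, hM⟩ : ∃ M : ℝ, 0 ≤ M ∧ ∀ γ, ‖f γ‖ ≤ M := by
    obtain ⟨hc, K, hKU, hK, h0⟩ := hfU
    obtain ⟨M, hM⟩ := hK.exists_bound_of_continuousOn (hc.mono hKU)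
    refine ⟨max M 0, le_max_right _ _, fun γ => ?_⟩
    by_cases hγ : γ ∈ K
    · exact (hM γ hγ).trans (le_max_left _ _)
    · rw [h0 γ hγ, norm_zero]; exact le_max_right _ _
  refine ⟨M, hM0, fun ξ => ?_⟩
  have hp : 0 < (2 : ℝ≥0∞).toReal := by norm_num
  have hsum : ∀ s : Finset (units : Set G),
      ∑ y ∈ s, ‖orbitAct f ξ y‖ ^ (2 : ℝ≥0∞).toReal ≤ (M * ‖ξ‖) ^ (2 : ℝ≥0∞).toReal := by
    intro s
    classical
    let s' := s.filter fun y => orbitAct f ξ y ≠ 0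
    -- `φ y` will be the arrow of `U` ending at `y`; `y` itself is a dummy value off `r(U)`, where
    -- the function vanishes. On `s'` the map sending `y` to the source of `φ y` is injective, so
    -- each entry of `ξ` is used at most once.
    have hex : ∀ y : (units : Set G), ∃ α : G, orbitAct f ξ y ≠ 0 → α ∈ U ∧ rng α = y.1 := by
      intro y
      by_cases h : ∃ α ∈ U, rng α = y.1
      · obtain ⟨α, hα, hy⟩ := h
        exact ⟨α, fun _ => ⟨hα, hy⟩⟩
      · push Not at h
        exact ⟨y.1, fun h2 => absurd (orbitAct_of_forall hfU h _) h2⟩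
    choose φ hφ using hex
    have hle : ∀ y ∈ s', ‖orbitAct f ξ y‖ ≤ M * ‖ξ ⟨src (φ y), src_mem _⟩‖ := by
      intro y hy
      obtain ⟨h1, h2⟩ := hφ y (Finset.mem_filter.1 hy).2
      have h3 : y = rngUnit (φ y) := Subtype.ext h2.symm
      have h4 : orbitAct f ξ y = _ :=
        (congrArg (orbitAct f ξ) h3).trans (orbitAct_of_mem hUb hfU h1 ξ)
      rw [h4, norm_mul]
      exact mul_le_mul_of_nonneg_right (hM _) (norm_nonneg _)
    have hinj : Set.InjOn (fun y => (⟨src (φ y), src_mem _⟩ : (units : Set G))) s' := by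
      intro y hy z hz h
      obtain ⟨h1, h2⟩ := hφ y (Finset.mem_filter.1 hy).2
      obtain ⟨h3, h4⟩ := hφ z (Finset.mem_filter.1 hz).2
      have h5 : φ y = φ z := hUb.1 h1 h3 (congrArg Subtype.val h)
      exact Subtype.ext (by rw [← h2, ← h4, h5])
    calc ∑ y ∈ s, ‖orbitAct f ξ y‖ ^ (2 : ℝ≥0∞).toReal
        = ∑ y ∈ s', ‖orbitAct f ξ y‖ ^ (2 : ℝ≥0∞).toReal := by
          refine (Finset.sum_filter_of_ne fun y _ h => ?_).symm
          intro h2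
          simp [h2] at h
      _ ≤ ∑ y ∈ s', M ^ (2 : ℝ≥0∞).toReal *
            ‖ξ ⟨src (φ y), src_mem _⟩‖ ^ (2 : ℝ≥0∞).toReal := by
          refine Finset.sum_le_sum fun y hy => ?_
          rw [← Real.mul_rpow hM0 (norm_nonneg _)]
          exact Real.rpow_le_rpow (norm_nonneg _) (hle y hy) hp.le
      _ = M ^ (2 : ℝ≥0∞).toReal *
            ∑ x ∈ s'.image fun y => (⟨src (φ y), src_mem _⟩ : (units : Set G)),
              ‖ξ x‖ ^ (2 : ℝ≥0∞).toReal := by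
          rw [← Finset.mul_sum, Finset.sum_image hinj]
      _ ≤ M ^ (2 : ℝ≥0∞).toReal * ‖ξ‖ ^ (2 : ℝ≥0∞).toReal :=
          mul_le_mul_of_nonneg_left (lp.sum_rpow_le_norm_rpow hp ξ _) (by positivity)
      _ = _ := (Real.mul_rpow hM0 (norm_nonneg _)).symm
  refine ⟨⟨orbitAct f ξ, memℓp_gen' hsum⟩, fun γ => rfl, ?_⟩
  exact lp.norm_le_of_forall_sum_le hp (by positivity) hsum

variable [IsEtaleGroupoid G]

theorem orbitAct_bound {f : G → ℂ} (hf : f ∈ ccSpan G) :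
    ∃ C : ℝ, 0 ≤ C ∧ ∀ ξ : L2Units G, ∃ η : L2Units G,
      (∀ y, η y = orbitAct f ξ y) ∧ ‖η‖ ≤ C * ‖ξ‖ := by
  rw [ccSpan_eq_span_bisection] at hf
  induction hf using Submodule.span_induction with
  | mem f h => exact orbitAct_bound_bisection h
  | zero =>
    refine ⟨0, le_rfl, fun ξ => ⟨0, fun y => ?_, by simp⟩⟩
    simp [orbitAct, leftAct]
  | add f g h1 h2 ih1 ih2 =>
    rw [← ccSpan_eq_span_bisection] at h1 h2
    obtain ⟨C, hC0, hC⟩ := ih1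
    obtain ⟨D, hD0, hD⟩ := ih2
    refine ⟨C + D, add_nonneg hC0 hD0, fun ξ => ?_⟩
    obtain ⟨η, hη, hη'⟩ := hC ξ
    obtain ⟨ζ, hζ, hζ'⟩ := hD ξ
    refine ⟨η + ζ, fun y => ?_, ?_⟩
    · rw [lp.coeFn_add, Pi.add_apply, hη, hζ,
        orbitAct_add_left (finiteOnFibers h1) (finiteOnFibers h2)]
      rfl
    · rw [add_mul]
      exact (norm_add_le _ _).trans (add_le_add hη' hζ')
  | smul c f h ih =>
    obtain ⟨C, hC0, hC⟩ := ih
    refine ⟨‖c‖ * C, by positivity, fun ξ => ?_⟩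
    obtain ⟨η, hη, hη'⟩ := hC ξ
    refine ⟨c • η, fun y => ?_, ?_⟩
    · rw [lp.coeFn_smul, Pi.smul_apply, hη, orbitAct_smul_left]
      rfl
    · rw [norm_smul, mul_assoc]
      exact mul_le_mul_of_nonneg_left hη' (norm_nonneg _)

theorem orbitAct_memℓp (f : CcAlg G) (ξ : L2Units G) :
    Memℓp (orbitAct f.toFn (fun x => ξ x)) 2 := by
  obtain ⟨C, -, hC⟩ := orbitAct_bound f.2
  obtain ⟨η, hη, -⟩ := hC ξ
  have : (fun y => η y) = orbitAct f.toFn (fun x => ξ x) := funext hη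
  exact this ▸ η.2

/-- The operator on `ℓ²(G⁽⁰⁾)` defined by an element of `𝒞(G)`. -/
noncomputable def orbitOp (f : CcAlg G) : L2Units G →L[ℂ] L2Units G :=
  LinearMap.mkContinuousOfExistsBound
    { toFun := fun ξ => ⟨orbitAct f.toFn (fun x => ξ x), orbitAct_memℓp f ξ⟩
      map_add' := fun ξ η =>
        lp.ext (orbitAct_add_right (finiteOnFibers f.2) (fun x => ξ x) (fun x => η x))
      map_smul' := fun c ξ => lp.ext (orbitAct_smul_right c f.toFn (fun x => ξ x)) }
    (by
      obtain ⟨C, -, hC⟩ := orbitAct_bound f.2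
      refine ⟨C, fun ξ => ?_⟩
      obtain ⟨η, hη, hη'⟩ := hC ξ
      refine le_of_eq_of_le (congrArg norm ?_) hη'
      exact lp.ext (funext fun y => (hη y).symm))

theorem orbitOp_apply (f : CcAlg G) (ξ : L2Units G) (y : (units : Set G)) :
    orbitOp f ξ y = orbitAct f.toFn (fun x => ξ x) y := rfl

theorem clm_ext_single {ι : Type*} [DecidableEq ι] {S T : lp (fun _ : ι => ℂ) 2 →L[ℂ]
    lp (fun _ : ι => ℂ) 2} (h : ∀ i j, S (lp.single 2 i 1) j = T (lp.single 2 i 1) j) :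
    S = T := by
  refine ContinuousLinearMap.ext fun ξ => ?_
  have hs := lp.hasSum_single (p := 2) (by norm_num) ξ
  have e : ∀ i, S (lp.single 2 i (ξ i)) = T (lp.single 2 i (ξ i)) := by
    intro i
    have h1 : lp.single (E := fun _ : ι => ℂ) 2 i (ξ i) = ξ i • lp.single 2 i (1 : ℂ) := by
      simp [← lp.single_smul]
    rw [h1, map_smul, map_smul, lp.ext (funext (h i))]
  have h1 := hs.mapL S
  have h2 := hs.mapL T
  simp only [e] at h1
  exact h1.unique h2

/-- The representation of `𝒞(G)` on `ℓ²(G⁽⁰⁾)` through the orbit equivalence relation. -/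
noncomputable def orbitRep : CcAlg G →⋆ₙₐ[ℂ] (L2Units G →L[ℂ] L2Units G) where
  toFun := orbitOp
  map_smul' c f := ContinuousLinearMap.ext fun ξ => lp.ext (orbitAct_smul_left c f.toFn _)
  map_zero' := ContinuousLinearMap.ext fun ξ => lp.ext (by
    have := orbitAct_smul_left 0 (0 : G → ℂ) (fun x => ξ x)
    rw [zero_smul, zero_smul] at this
    exact this)
  map_add' f g := ContinuousLinearMap.ext fun ξ => lp.ext
    (orbitAct_add_left (finiteOnFibers f.2) (finiteOnFibers g.2) _)
  map_mul' f g := ContinuousLinearMap.ext fun ξ => lp.ext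
    (orbitAct_conv (finiteOnFibers f.2) (finiteOnFibers g.2) _)
  map_star' f := by
    classical
    refine clm_ext_single fun x y => ?_
    have h1 : star (orbitOp f) (lp.single 2 x (1 : ℂ)) y
        = inner ℂ (lp.single (E := fun _ : (units : Set G) => ℂ) 2 y (1 : ℂ))
          (star (orbitOp f) (lp.single 2 x (1 : ℂ))) := by
      simp [lp.inner_single_left]
    rw [h1, ContinuousLinearMap.star_eq_adjoint, ContinuousLinearMap.adjoint_inner_right,
      ← inner_conj_symm, lp.inner_single_left, orbitOp_apply, orbitOp_apply, CcAlg.toFn_star]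
    simp only [lp.coeFn_single, orbitAct_single_invol]
    simp

/-- The orbit representation of `C*(G)`. -/
noncomputable def orbitRepFull : FullCStar G →⋆ₙₐ[ℂ] (L2Units G →L[ℂ] L2Units G) :=
  extendRep orbitRep

theorem orbitRepFull_toFull (f : CcAlg G) : orbitRepFull (toFull f) = orbitOp f :=
  extend_rep_coe orbitRep f

theorem orbitAct_units {h : G → ℂ} (hh : h ∈ CcOn (units : Set G)) (ξ : ↥(units : Set G) → ℂ)
    (y : (units : Set G)) : orbitAct h ξ y = h y.1 * ξ y := by
  have h1 : y = rngUnit y.1 := Subtype.ext (rng_unit _ y.2).symm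
  have h2 : (⟨src y.1, src_mem _⟩ : (units : Set G)) = y := Subtype.ext (src_unit _ y.2)
  calc orbitAct h ξ y = orbitAct h ξ (rngUnit y.1) := congrArg _ h1
    _ = h y.1 * ξ y := by rw [orbitAct_of_mem isBisection_units hh y.2, h2]

theorem norm_le_norm_orbitOp {h : G → ℂ} (hh : h ∈ CcOn (units : Set G)) {x : G}
    (hx : x ∈ (units : Set G)) : ‖h x‖ ≤ ‖orbitOp (ofUnits h hh)‖ := by
  classical
  let d : L2Units G := lp.single 2 ⟨x, hx⟩ (1 : ℂ)
  have h1 : orbitOp (ofUnits h hh) d ⟨x, hx⟩ = h x := by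
    rw [orbitOp_apply, toFn_ofUnits, orbitAct_units hh]
    simp [d]
  have h2 : ‖d‖ = 1 := by simp [d, lp.norm_single]
  calc ‖h x‖ ≤ ‖orbitOp (ofUnits h hh) d‖ := by
        rw [← h1]
        exact lp.norm_apply_le_norm (by norm_num) _ _
    _ ≤ ‖orbitOp (ofUnits h hh)‖ * ‖d‖ := ContinuousLinearMap.le_opNorm _ _
    _ = _ := by rw [h2, mul_one]

/-- For `b` in the kernel and `f` in `C_c(G⁽⁰⁾)`, `|f(x)|` is at most the norm of the operator of
`f`, which is also that of `f - b`, hence at most `‖f - b‖`. By `eq_zero_of_mem_diagonal` the kernel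
meets the diagonal trivially. -/
theorem FullUniqueness.orbitRepFull_eq_zero (hG : FullUniqueness G) {a : FullCStar G}
    (ha : orbitRepFull a = 0) : a = 0 := by
  have hbot : TwoSidedIdeal.ker (orbitRepFull (G := G)) = ⊥ := by
    by_contra hne
    refine hG _ ?_ hne (inter_diagonal_eq_singleton fun b hb hd => ?_)
    · have : (TwoSidedIdeal.ker (orbitRepFull (G := G)) : Set (FullCStar G))
          = {a | orbitRepFull a = 0} := Set.ext fun a => TwoSidedIdeal.mem_ker _
      rw [this]
      exact isClosed_eq (continuous_extend_rep orbitRep) continuous_const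
    · refine eq_zero_of_mem_diagonal hd fun f hf x hx => ?_
      have h1 := NonUnitalStarAlgHom.norm_apply_le (orbitRepFull (G := G))
        (toFull (ofUnits f hf) - b)
      rw [map_sub, (TwoSidedIdeal.mem_ker _).1 hb, sub_zero, orbitRepFull_toFull] at h1
      exact (norm_le_norm_orbitOp hf hx).trans h1
  have h1 : a ∈ TwoSidedIdeal.ker (orbitRepFull (G := G)) := (TwoSidedIdeal.mem_ker _).2 ha
  rw [hbot] at h1
  exact (TwoSidedIdeal.mem_bot _).1 h1

/-- The pull-back of a function on the unit space along the source map of a bisection. -/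
theorem exists_ccOn_bisection_comp_src {U : Set G} (hU : IsOpen U) (hUb : IsBisection U) {γ : G}
    (hγ : γ ∈ U) : ∃ g ∈ CcOn (units : Set G), ∃ f ∈ CcOn U, f γ = 1 ∧
      (∀ α ∈ U, f α = g (src α)) ∧ ∀ x, x ∉ src '' U → g x = 0 := by
  have hT2 := IsEtaleGroupoid.t2_units (G := G)
  have hV : IsOpen (src '' U : Set G) := isOpen_image_src hU
  have hVu : src '' U ⊆ (units : Set G) := by
    rintro _ ⟨α, -, rfl⟩
    exact src_mem α
  have hV2 : T2Space (src '' U : Set G) := by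
    exact (Topology.IsEmbedding.inclusion hVu).t2Space
  obtain ⟨g, hg, hg1, -⟩ := exists_bump hV hV2 (mem_image_of_mem src hγ)
  classical
  refine ⟨g, mem_CcOn_of_subset hVu hg hV hT2, fun α => if α ∈ U then g (src α) else 0, ?_, ?_, ?_, ?_⟩
  · obtain ⟨hc, K, hKV, hK, h0⟩ := hg
    refine ⟨?_, U ∩ src ⁻¹' K, inter_subset_left, ?_, ?_⟩
    · refine (hc.comp continuous_src.continuousOn fun α hα => mem_image_of_mem src hα).congr ?_
      intro α hα
      simp [hα]
    -- The source map embeds `U` into the unit space and `K` lies in its image, so the preimage of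
    -- `K` in `U` is compact.
    · have hK' : IsCompact ((↑) ⁻¹' K : Set (units : Set G)) :=
        Topology.IsInducing.subtypeVal.isCompact_preimage_iff (by
          rw [Subtype.range_coe]; exact hKV.trans hVu) |>.2 hK
      have h1 := (isOpenEmbedding_srcUnit hU hUb).isInducing.isCompact_preimage_iff (K := (↑) ⁻¹' K)
        (by
          rintro x hx
          obtain ⟨α, hα, hx⟩ := hKV hx
          exact ⟨⟨α, hα⟩, Subtype.ext hx⟩) |>.2 hK'
      convert h1.image continuous_subtype_val using 1
      ext α
      constructor
      · rintro ⟨hα, h⟩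
        exact ⟨⟨α, hα⟩, h, rfl⟩
      · rintro ⟨α, h, rfl⟩
        exact ⟨α.2, h⟩
    · intro α hα
      by_cases h : α ∈ U
      · refine (if_pos h).trans ?_
        exact h0 _ fun h2 => hα ⟨h, h2⟩
      · exact if_neg h
  · simp [hγ, hg1]
  · intro α hα
    simp [hα]
  · intro x hx
    exact eq_zero_of_mem_CcOn hg hx

/-- For a bisection `U` in the isotropy, `f` on `U` and `g` on `s(U)` with `f = g ∘ s` define the
same operator on `ℓ²(G⁽⁰⁾)`, since each arrow of `U` fixes its unit. Faithfulness gives `f = g`; but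
`f(γ) = 1`, while `g` vanishes off the units. -/
theorem FullUniqueness.isEffective (hG : FullUniqueness G) : IsEffectiveGroupoid G := by
  refine Subset.antisymm (interior_maximal (fun x hx => ?_) isOpen_units) fun γ hγ => ?_
  · exact (src_unit x hx).trans (rng_unit x hx).symm
  obtain ⟨U, hUi, hU, hγU, hUb⟩ := exists_bisection γ isOpen_interior hγ
  have hiso : ∀ α ∈ U, src α = rng α := fun α hα =>
    interior_subset (s := iso G) (hUi hα)
  obtain ⟨g, hg, f, hf, hf1, hfg, hg0⟩ := exists_ccOn_bisection_comp_src hU hUb hγU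
  let F : CcAlg G := ⟨f, bisectionFns_subset ⟨U, hU, hUb, hf⟩⟩
  have hop : orbitOp F = orbitOp (ofUnits g hg) := by
    refine ContinuousLinearMap.ext fun ξ => lp.ext (funext fun y => ?_)
    rw [orbitOp_apply, orbitOp_apply, toFn_ofUnits, orbitAct_units hg]
    change orbitAct f _ y = _
    by_cases h : ∃ α ∈ U, rng α = y.1
    · obtain ⟨α, hα, hy⟩ := h
      obtain rfl : rngUnit α = y := Subtype.ext hy
      have h2 : (⟨src α, src_mem α⟩ : (units : Set G)) = rngUnit α := Subtype.ext (hiso α hα)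
      rw [orbitAct_of_mem hUb hf hα, h2, hfg α hα, hiso α hα]
      rfl
    · push Not at h
      rw [orbitAct_of_forall hf h, hg0, zero_mul]
      rintro ⟨α, hα, hy⟩
      exact h α hα ((hiso α hα).symm.trans hy)
  have h0 : toFull F - toFull (ofUnits g hg) = 0 := by
    refine hG.orbitRepFull_eq_zero ?_
    rw [map_sub, orbitRepFull_toFull, orbitRepFull_toFull, hop, sub_self]
  have h1 : f = g := congrArg CcAlg.toFn (toFull_injective (sub_eq_zero.1 h0))
  by_contra h
  rw [h1, eq_zero_of_mem_CcOn hg h] at hf1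
  exact zero_ne_one hf1

end OrbitRepresentation

end GroupoidCStar

namespace GroupoidCStar

/-! ### Compression near a unit with trivial isotropy -/

section Pinching

variable {G : Type u} [TopologicalSpace G] [SetGroupoid G]

theorem conv_units_left {h : G → ℂ} (hh : ∀ γ, γ ∉ (units : Set G) → h γ = 0) (g : G → ℂ)
    (γ : G) : conv h g γ = h (rng γ) * g γ := by
  rw [conv, finsum_eq_single _ (⟨γ, rfl⟩ : Fiber (src γ))]
  · change h (γ * γ⁻¹) * g γ = _
    rw [mul_inv_self]
  · intro β hβ
    rw [hh _ fun h1 => hβ (Subtype.ext ?_), zero_mul]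
    have h2 : γ * β.1⁻¹ * β.1 = γ := mul_inv_mul β.2.symm
    have h3 : γ * β.1⁻¹ = rng β.1 := by
      rw [← src_mul_inv β.2.symm, src_unit _ h1]
    rwa [h3, rng_mul_self] at h2

theorem conv_units_right {h : G → ℂ} (hh : ∀ γ, γ ∉ (units : Set G) → h γ = 0) (g : G → ℂ)
    (γ : G) : conv g h γ = g γ * h (src γ) := by
  rw [conv, finsum_eq_single _ (⟨src γ, src_src γ⟩ : Fiber (src γ))]
  · change g (γ * (src γ)⁻¹) * h (src γ) = _
    rw [inv_of_unit (src_mem γ), mul_src_self]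
  · intro β hβ
    rw [hh _ fun h1 => hβ (Subtype.ext ((src_unit _ h1).symm.trans β.2)), mul_zero]

variable [IsEtaleGroupoid G]

theorem exists_pinching_bisection {f : G → ℂ} (hf : f ∈ bisectionFns G) {x : G}
    (hx : x ∈ (units : Set G)) (hiso : ∀ α : G, src α = x → rng α = x → α = x) :
    ∃ W : Set G, IsOpen W ∧ x ∈ W ∧ W ⊆ units ∧ ContinuousOn f W ∧
      ∀ γ, src γ ∈ W → rng γ ∈ W → γ ∉ (units : Set G) → f γ = 0 := by
  have hT2 := IsEtaleGroupoid.t2_units (G := G)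
  obtain ⟨U, hU, hUb, hc, K, hKU, hK, h0⟩ := hf
  -- A unit in `W` is itself an arrow from `W` to `W`, so vanishing on all these arrows makes `f`
  -- zero on `W`.
  have hzero : ∀ W : Set G, W ⊆ units → (∀ γ, src γ ∈ W → rng γ ∈ W → f γ = 0) →
      ContinuousOn f W := fun W hW h => by
    refine (continuousOn_const (c := (0 : ℂ))).congr fun y hy => h y ?_ ?_
    · rwa [src_unit y (hW hy)]
    · rwa [rng_unit y (hW hy)]
  by_cases hα : ∃ α ∈ U, src α = x
  · obtain ⟨α, hα, hs⟩ := hα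
    by_cases hr : rng α = x
    · obtain rfl := hiso α hs hr
      -- Here `x` itself lies in `U`. An arrow of `U` whose source lies in `U` equals that source,
      -- by injectivity, so no non-unit contributes.
      refine ⟨U ∩ units, hU.inter isOpen_units, ⟨hα, hx⟩, inter_subset_right,
        hc.mono inter_subset_left, fun γ hγ _ hγu => h0 γ fun hγK => hγu ?_⟩
      have : γ = src γ := hUb.1 (hKU hγK) hγ.1 (src_src γ).symm
      rw [this]
      exact src_mem γ
    -- The arrow over `x` leaves `x`. Units in `V₁` whose arrow in `U` ends in `V₂` form a
    -- neighbourhood of `x` that no arrow of `U` maps into itself.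
    · obtain ⟨V₁, V₂, hV₁, hV₂, hx₁, hr₂, hdisj⟩ := t2_separation
        (show (⟨x, hx⟩ : (units : Set G)) ≠ rngUnit α from fun h =>
          hr (congrArg Subtype.val h).symm)
      have hr' : Continuous (rngUnit : G → (units : Set G)) := continuous_rng.subtype_mk _
      have hU' : IsOpen (U ∩ rngUnit ⁻¹' V₂) := hU.inter (hV₂.preimage hr')
      have key : ∀ γ, src γ ∈ (↑) '' V₁ ∩ src '' (U ∩ rngUnit ⁻¹' V₂) →
          rng γ ∈ (↑) '' V₁ ∩ src '' (U ∩ rngUnit ⁻¹' V₂) → f γ = 0 := by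
        intro γ hγ hγ'
        refine h0 γ fun hγK => ?_
        obtain ⟨-, β, ⟨hβU, hβV⟩, hβ⟩ := hγ
        obtain ⟨⟨y, hy, hyγ⟩, -⟩ := hγ'
        obtain rfl := hUb.1 hβU (hKU hγK) hβ
        have : y = rngUnit β := Subtype.ext hyγ
        subst this
        exact disjoint_left.1 hdisj hy hβV
      have hsub : ((↑) '' V₁ ∩ src '' (U ∩ rngUnit ⁻¹' V₂) : Set G) ⊆ units := by
        rintro _ ⟨⟨y, -, rfl⟩, -⟩
        exact y.2
      exact ⟨_, (isOpen_units.isOpenMap_subtype_val _ hV₁).inter (isOpen_image_src hU'),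
        ⟨⟨⟨x, hx⟩, hx₁, rfl⟩, α, ⟨hα, hr₂⟩, hs⟩, hsub, hzero _ hsub key,
        fun γ h1 h2 _ => key γ h1 h2⟩
  -- No arrow of `U` starts at `x`; it suffices to avoid `s(K)`, which is compact and hence closed
  -- in the Hausdorff unit space.
  · have hcl : IsClosed (srcUnit '' K : Set (units : Set G)) :=
      (hK.image isLocalHomeomorph_srcUnit.continuous).isClosed
    have key : ∀ γ, src γ ∈ ((↑) '' (srcUnit '' K)ᶜ : Set G) → f γ = 0 := by
      rintro γ ⟨y, hy, hyγ⟩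
      refine h0 γ fun hγK => hy ⟨γ, hγK, Subtype.ext hyγ.symm⟩
    have hsub : ((↑) '' (srcUnit '' K)ᶜ : Set G) ⊆ units := by
      rintro _ ⟨y, -, rfl⟩
      exact y.2
    refine ⟨_, isOpen_units.isOpenMap_subtype_val _ hcl.isOpen_compl,
      ⟨⟨x, hx⟩, ?_, rfl⟩, hsub, hzero _ hsub fun γ h1 _ => key γ h1, fun γ h1 _ _ => key γ h1⟩
    rintro ⟨α, hα', h⟩
    exact hα ⟨α, hKU hα', congrArg Subtype.val h⟩

/-- Finitely many bisection functions are involved, so their neighbourhoods can be intersected.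
Trivial isotropy yields both that `f` is continuous on a neighbourhood of `x` in the units, not
automatic in a non-Hausdorff groupoid, and that a bump function on `W` cuts `f` down to the units.
-/
theorem exists_pinching {f : G → ℂ} (hf : f ∈ ccSpan G) {x : G}
    (hx : x ∈ (units : Set G)) (hiso : ∀ α : G, src α = x → rng α = x → α = x) :
    ∃ W : Set G, IsOpen W ∧ x ∈ W ∧ W ⊆ units ∧ ContinuousOn f W ∧
      ∀ γ, src γ ∈ W → rng γ ∈ W → γ ∉ (units : Set G) → f γ = 0 := by
  rw [ccSpan_eq_span_bisection] at hf
  induction hf using Submodule.span_induction with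
  | mem f h => exact exists_pinching_bisection h hx hiso
  | zero => exact ⟨units, isOpen_units, hx, subset_rfl, continuousOn_const, fun _ _ _ _ => rfl⟩
  | add f g _ _ h1 h2 =>
    obtain ⟨V, hV, hxV, hVu, hfc, hf⟩ := h1
    obtain ⟨W, hW, hxW, -, hgc, hg⟩ := h2
    refine ⟨V ∩ W, hV.inter hW, ⟨hxV, hxW⟩, inter_subset_left.trans hVu,
      (hfc.mono inter_subset_left).add (hgc.mono inter_subset_right), fun γ h3 h4 h5 => ?_⟩
    rw [Pi.add_apply, hf γ h3.1 h4.1 h5, hg γ h3.2 h4.2 h5, add_zero]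
  | smul c f _ h =>
    obtain ⟨V, hV, hxV, hVu, hfc, hf⟩ := h
    refine ⟨V, hV, hxV, hVu, hfc.const_smul c, fun γ h3 h4 h5 => ?_⟩
    rw [Pi.smul_apply, hf γ h3 h4 h5, smul_zero]

/-- Near a unit with trivial isotropy, compressing by a bump function moves `f` into
`C_c(G⁽⁰⁾)`. -/
theorem exists_compression {f : CcAlg G} {x : G} (hx : x ∈ (units : Set G))
    (hiso : ∀ α : G, src α = x → rng α = x → α = x) :
    ∃ (h : G → ℂ) (hh : h ∈ CcOn (units : Set G)) (k : G → ℂ) (hk : k ∈ CcOn (units : Set G)),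
      (∀ γ, ‖h γ‖ ≤ 1) ∧ k x = f.toFn x ∧ ofUnits h hh * f * ofUnits h hh = ofUnits k hk := by
  have hT2 := IsEtaleGroupoid.t2_units (G := G)
  obtain ⟨W, hW, hxW, hWu, hfc, hf⟩ := exists_pinching f.2 hx hiso
  have hWT : T2Space W := (Topology.IsEmbedding.inclusion hWu).t2Space
  obtain ⟨h, hhW, hx1, hle⟩ := exists_bump hW hWT hxW
  have hh := mem_CcOn_of_subset hWu hhW hW hT2
  have hk : (fun γ => h γ * f.toFn γ * h γ) ∈ CcOn (units : Set G) := by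
    refine mem_CcOn_of_subset hWu ⟨(hhW.1.mul hfc).mul hhW.1, ?_⟩ hW hT2
    obtain ⟨-, K, hKW, hK, h0⟩ := hhW
    exact ⟨K, hKW, hK, fun γ hγ => by simp [h0 γ hγ]⟩
  have h0 : ∀ γ, γ ∉ (units : Set G) → h γ = 0 := fun γ hγ => eq_zero_of_mem_CcOn hh hγ
  refine ⟨h, hh, _, hk, hle, by simp [hx1], CcAlg.ext (funext fun γ => ?_)⟩
  rw [CcAlg.toFn_mul, CcAlg.toFn_mul, toFn_ofUnits, toFn_ofUnits, conv_units_right h0,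
    conv_units_left h0]
  by_cases hγ : γ ∈ (units : Set G)
  · rw [src_unit γ hγ, rng_unit γ hγ]
  · rw [h0 γ hγ, zero_mul, zero_mul]
    by_cases hs : src γ ∈ W
    · by_cases hr : rng γ ∈ W
      · have hfγ : f.toFn γ = 0 := hf γ hs hr hγ
        rw [hfγ, mul_zero, zero_mul]
      · rw [eq_zero_of_mem_CcOn hhW hr, zero_mul, zero_mul]
    · rw [eq_zero_of_mem_CcOn hhW hs, mul_zero]

end Pinching

/-! ### Ideals that meet the diagonal trivially -/

section UniquenessOfEffective

variable {G : Type u} [TopologicalSpace G] [SetGroupoid G] [IsEtaleGroupoid G]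

/-- If `k ∈ C_c(G⁽⁰⁾)` is `δ`-close to `b ∈ I`, then every element of `C_c(W)`, for `W` open
with `|k| > 2δ` on `W`, is arbitrarily close to `I`. -/
theorem exists_near_of_lt {I : TwoSidedIdeal (FullCStar G)} {k : G → ℂ}
    (hk : k ∈ CcOn (units : Set G)) {b : FullCStar G} (hb : b ∈ I) {δ : ℝ} (hδ : 0 < δ)
    (hkb : ‖toFull (ofUnits k hk) - b‖ ≤ δ) {W : Set G} (hW : IsOpen W) (hWu : W ⊆ units)
    (hkW : ∀ γ ∈ W, 2 * δ < ‖k γ‖) (n : ℕ) {v : G → ℂ} (hv : v ∈ CcOn W) {C : ℝ} (hC0 : 0 ≤ C)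
    (hC : ∀ γ, ‖v γ‖ ≤ C) : ∃ i ∈ I, ∃ hv' : v ∈ CcOn (units : Set G),
      ‖toFull (ofUnits v hv') - i‖ ≤ 2 * C * (1 / 2) ^ n := by
  have hT2 := IsEtaleGroupoid.t2_units (G := G)
  have hv' := mem_CcOn_of_subset hWu hv hW hT2
  induction n generalizing v C with
  | zero =>
    refine ⟨0, I.zero_mem, hv', ?_⟩
    rw [sub_zero, pow_zero, mul_one]
    exact norm_toFull_ofUnits_le hv' hC hC0
  | succ n ih =>
    have hk0 : ∀ γ ∈ W, k γ ≠ 0 := fun γ hγ h => by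
      have := hkW γ hγ
      rw [h, norm_zero] at this
      linarith
    -- Write `v = w k` with `w = v / k`, of size at most `C / (2δ)`, and apply the induction
    -- hypothesis to `w`.
    have hw : (fun γ => v γ / k γ) ∈ CcOn W := by
      obtain ⟨hc, K, hKW, hK, h0⟩ := hv
      exact ⟨hc.div (hk.1.mono hWu) hk0, K, hKW, hK, fun γ hγ => by simp [h0 γ hγ]⟩
    have hwC : ∀ γ, ‖v γ / k γ‖ ≤ C / (2 * δ) := by
      intro γ
      by_cases hγ : γ ∈ W
      · rw [norm_div]
        exact div_le_div₀ hC0 (hC γ) (by positivity) (hkW γ hγ).le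
      · rw [eq_zero_of_mem_CcOn hv hγ, zero_div, norm_zero]
        positivity
    obtain ⟨i, hi, hw', hwi⟩ := ih hw (by positivity) hwC (mem_CcOn_of_subset hWu hw hW hT2)
    have hprod : ofUnits v hv' = ofUnits _ hw' * ofUnits k hk := by
      refine CcAlg.ext (funext fun γ => ?_)
      rw [CcAlg.toFn_mul, toFn_ofUnits, toFn_ofUnits, toFn_ofUnits,
        conv_of_units (fun γ hγ => eq_zero_of_mem_CcOn hw' hγ)
          (fun γ hγ => eq_zero_of_mem_CcOn hk hγ)]
      by_cases hγ : γ ∈ W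
      · exact (div_mul_cancel₀ _ (hk0 γ hγ)).symm
      · simp [eq_zero_of_mem_CcOn hv hγ]
    set w := toFull (ofUnits _ hw')
    set c := toFull (ofUnits k hk)
    -- With this element of `I` the error factors as `(w - i)(c - b)`; the factor `1 / (2δ)` from
    -- dividing by `k` against `δ` from `c - b` halves the bound.
    refine ⟨i * c + (w - i) * b,
      I.add_mem (I.mul_mem_right _ _ hi) (I.mul_mem_left _ _ hb), hv', ?_⟩
    have e : toFull (ofUnits v hv') - (i * c + (w - i) * b) = (w - i) * (c - b) := by
      rw [hprod, toFull_mul]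
      change w * c - _ = _
      noncomm_ring
    rw [e]
    calc ‖(w - i) * (c - b)‖ ≤ ‖w - i‖ * ‖c - b‖ := norm_mul_le _ _
      _ ≤ (2 * (C / (2 * δ)) * (1 / 2) ^ n) * δ :=
        mul_le_mul hwi hkb (norm_nonneg _) (by positivity)
      _ = 2 * C * (1 / 2) ^ (n + 1) := by
        rw [pow_succ]
        field_simp

/-- A closed ideal that meets the diagonal trivially consists of elements whose function vanishes
at the units with trivial isotropy. -/
theorem coeff_eq_zero_of_trivial_isotropy {I : TwoSidedIdeal (FullCStar G)}
    (hI : IsClosed (I : Set (FullCStar G)))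
    (hd : (I : Set (FullCStar G)) ∩ diagonal G = {0}) {a : FullCStar G} (ha : a ∈ I) {x : G}
    (hx : x ∈ (units : Set G)) (hiso : ∀ α : G, src α = x → rng α = x → α = x) :
    coeff a x = 0 := by
  by_contra hne
  have hT2 := IsEtaleGroupoid.t2_units (G := G)
  have hpos : 0 < ‖coeff a x‖ := norm_pos_iff.2 hne
  -- Since `‖p‖ ≤ 2`, compression turns the error `ε` into `4ε`. The approximation lemma needs
  -- `|k(x)| > 8ε`, and `|k(x)| = |f(x)|` is more than `10ε - ε`.
  set ε := ‖coeff a x‖ / 10 with hε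
  have hε0 : 0 < ε := by positivity
  obtain ⟨f, hfa⟩ := exists_toFull_near a hε0
  obtain ⟨h, hh, k, hk, hle, hkx, hmul⟩ := exists_compression (f := f) hx hiso
  set p := toFull (ofUnits h hh) with hp
  have hpn : ‖p‖ ≤ 2 := by
    have := norm_toFull_ofUnits_le hh hle zero_le_one
    rwa [mul_one] at this
  have hb : p * a * p ∈ I := I.mul_mem_right _ _ (I.mul_mem_left _ _ ha)
  have hkb : ‖toFull (ofUnits k hk) - p * a * p‖ ≤ 4 * ε := by
    have e : toFull (ofUnits k hk) - p * a * p = p * (toFull f - a) * p := by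
      rw [← hmul, toFull_mul, toFull_mul]
      change p * toFull f * p - _ = _
      noncomm_ring
    rw [e]
    calc ‖p * (toFull f - a) * p‖ ≤ ‖p‖ * ‖toFull f - a‖ * ‖p‖ :=
          (norm_mul_le _ _).trans (mul_le_mul_of_nonneg_right (norm_mul_le _ _) (norm_nonneg _))
      _ ≤ 2 * ε * 2 := by gcongr
      _ = 4 * ε := by ring
  have hkx' : 2 * (4 * ε) < ‖k x‖ := by
    have h1 := norm_sub_coeff_le f a x
    have h2 := norm_sub_norm_le (coeff a x) (f.toFn x)
    rw [norm_sub_rev] at h2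
    rw [hkx]
    linarith
  have hW : IsOpen ((units : Set G) ∩ (fun γ => ‖k γ‖) ⁻¹' Ioi (2 * (4 * ε))) :=
    hk.1.norm.isOpen_inter_preimage isOpen_units isOpen_Ioi
  set W := (units : Set G) ∩ (fun γ => ‖k γ‖) ⁻¹' Ioi (2 * (4 * ε))
  have hWu : W ⊆ units := inter_subset_left
  obtain ⟨v, hv, hvx, hv1⟩ := exists_bump hW (Topology.IsEmbedding.inclusion hWu).t2Space
    (show x ∈ W from ⟨hx, hkx'⟩)
  have hv' := mem_CcOn_of_subset hWu hv hW hT2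
  -- The bump function `v` is a limit of elements of `I`, so it is a nonzero diagonal element of the
  -- closed ideal.
  have hmem : toFull (ofUnits v hv') ∈ (I : Set (FullCStar G)) := by
    rw [← hI.closure_eq, Metric.mem_closure_iff]
    intro r hr
    obtain ⟨n, hn⟩ := exists_pow_lt_of_lt_one (half_pos hr) (by norm_num : (1 / 2 : ℝ) < 1)
    obtain ⟨i, hi, _, hvi⟩ := exists_near_of_lt hk hb (by positivity) hkb hW hWu
      (fun γ hγ => hγ.2) n hv zero_le_one hv1
    refine ⟨i, hi, ?_⟩
    rw [dist_eq_norm]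
    linarith
  have h0 : toFull (ofUnits v hv') ∈ (I : Set (FullCStar G)) ∩ diagonal G :=
    ⟨hmem, subset_closure ⟨_, hv', rfl⟩⟩
  rw [hd, mem_singleton_iff] at h0
  have h1 := coeff_toFull (ofUnits v hv') x
  rw [h0, coeff_zero, toFn_ofUnits, hvx] at h1
  exact zero_ne_one h1

/-- If `a ∈ I` were not singular, its function would be nonzero at some `γ` whose source has trivial
isotropy. Multiplying by the adjoint of a bisection function moves this value to the unit `s(γ)`,
where elements of `I` have coefficient zero. -/
theorem fullUniqueness_of_isEffective [SecondCountableTopology G] (hG : IsEffectiveGroupoid G)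
    (hs : ∀ a : FullCStar G, IsSingular a → a = 0) : FullUniqueness G := by
  intro I hI hne hd
  refine hne (eq_bot_iff.2 fun a ha => (TwoSidedIdeal.mem_bot _).2 (hs a ?_))
  rw [isSingular_iff]
  by_contra h
  obtain ⟨γ, hγ, hiso⟩ := exists_trivial_isotropy hG isOpen_interior
    (nonempty_iff_ne_empty.2 h)
  obtain ⟨U, -, hU, hγU, hUb⟩ := exists_bisection γ isOpen_univ (mem_univ γ)
  obtain ⟨f, hf, hf1, -⟩ := exists_bump hU hUb.t2Space hγU
  let F : CcAlg G := ⟨f, bisectionFns_subset ⟨U, hU, hUb, hf⟩⟩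
  have h1 := coeff_star_mul hUb F hf hγU hf1 a
  rw [coeff_eq_zero_of_trivial_isotropy hI hd (I.mul_mem_left _ _ ha) (src_mem γ) hiso] at h1
  exact interior_subset hγ h1.symm

end UniquenessOfEffective

end GroupoidCStar

theorem mainTheorem10 (G : Type u) [TopologicalSpace G] [SetGroupoid G] [IsEtaleGroupoid G]
    [SecondCountableTopology G] :
    GroupoidCStar.FullUniqueness G ↔
      IsEffectiveGroupoid G ∧
        ∀ a : GroupoidCStar.FullCStar G, GroupoidCStar.IsSingular a → a = 0 :=

  ⟨fun h => ⟨h.isEffective, fun _ => h.eq_zero_of_isSingular⟩,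
    fun h => GroupoidCStar.fullUniqueness_of_isEffective h.1 h.2⟩
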